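/- Let $K$ be an algebraically closed field of characteristic $p>0$, let $d\ge 1$, $n\ge d+1$ and $k\ge 2$ be integers with $\gcd(k,p)=1$, and let $\omega_k\in K$ be a primitive $k$-th root of unity. For $\rho\in K^{d+1}\setminus\{0\}$ put $\Sigma(\rho)=\{\rho_1x_1+\cdots+\rho_{d+1}x_{d+1}=0\}\subset\mathbb P^d_K$. Hyperplanes of $\mathbb P^d_K$ are in general position if they are pairwise different and any $s$ of them, $2\le s\le d+1$, meet in a plane of dimension $d-s$ (the empty set if $s=d+1$). A generalized Fermat pair of type $(d;k,n)$ is a pair $(X,H)$, where $X\subset\mathbb P^m_K$ is a smooth irreducible projective variety of dimension $d$ and $\mathbb Z_k^n\cong H<\mathrm{Aut}(X)$, for which there is a Galois branched cover $\pi\colon X\to\mathbb P^d_K$ with deck group $H$ (i.e. $\pi$ is the quotient morphism $X\to X/H=\mathbb P^d_K$, and $H$ consists of all $g\in\mathrm{Aut}(X)$ with $\pi\circ g=\pi$) whose branch divisor consists of $n+1$ hyperplanes in general position, each of branch order $k$. Here the branch locus is the image under $\pi$ of the set of points of $X$ with non-trivial stabilizer in $H$, and a hyperplane $\Sigma$ has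 branch order $k$ if the inertia group $\{h\in H : h|_T=\mathrm{id}_T\}$ of every irreducible component $T$ of $\pi^{-1}(\Sigma)$ has order $k$. Let $\Lambda=(\lambda_{i,j})$, $1\le i\le n-d-1$, $1\le j\le d$, with $\lambda_{i,j}\in K$ ($\Lambda$ is empty if $n=d+1$). Put $\Sigma_j(\Lambda)=\{x_j=0\}$ for $1\le j\le d+1$, $\Sigma_{d+2}(\Lambda)=\{x_1+\cdots+x_{d+1}=0\}$ and $\Sigma_{d+2+i}(\Lambda)=\{\lambda_{i,1}x_1+\cdots+\lambda_{i,d}x_d+x_{d+1}=0\}$ for $1\le i\le n-d-1$, and assume that these $n+1$ hyperplanes of $\mathbb P^d_K$ are in general position. Let $X^k_n(\Lambda)\subset\mathbb P^n_K$ be the set defined by the equations $$x_1^k+\cdots+x_{d+1}^k+x_{d+2}^k=0,\qquad \lambda_{i,1}x_1^k+\cdots+\lambda_{i,d}x_d^k+x_{d+1}^k+x_{d+2+i}^k=0\quad(1\le i\le n-d-1),$$ and let $H_0=\langle\varphi_1,\dots,\varphi_{n+1}\rangle$, where $\varphi_j$ is the restriction to $X^k_n(\Lambda)$ of $[x_1:\cdots:x_j:\cdots:x_{n+1}]\mapsto[x_1:\cdots:\omega_kx_j:\cdots:x_{n+1}]$.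 Theorem. $(X^k_n(\Lambda),H_0)$ is a generalized Fermat pair of type $(d;k,n)$. More precisely, $X^k_n(\Lambda)$ is a smooth irreducible projective variety of dimension $d$, $H_0\cong\mathbb Z_k^n$ is a subgroup of $\mathrm{Aut}(X^k_n(\Lambda))$, and the map $$\pi_0\colon X^k_n(\Lambda)\to\mathbb P^d_K,\qquad [x_1:\cdots:x_{n+1}]\mapsto[x_1^k:\cdots:x_{d+1}^k],$$ is a Galois branched cover with deck group $H_0$, whose branch locus is $\Sigma_1(\Lambda)\cup\cdots\cup\Sigma_{n+1}(\Lambda)$, each $\Sigma_j(\Lambda)$ having branch order $k$. -/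

import Mathlib

open scoped LinearAlgebra.Projectivization

noncomputable section

namespace FermatPair

/-! ## Projective varieties over a field (meant for an algebraically closed one) -/

/-- Projective space of dimension `m` over `K`. -/
abbrev PSpace (K : Type*) [Field K] (m : ℕ) : Type _ := ℙ K (Fin (m + 1) → K)

variable {K : Type*} [Field K] {m m' : ℕ}

/-- The polynomial `f` vanishes at the point `P`. For homogeneous `f`, the only case in which this
is used, the choice of the coordinate vector of `P` does not matter. -/
def VanishesAt (f : MvPolynomial (Fin (m + 1)) K) (P : PSpace K m) : Prop :=
  MvPolynomial.eval P.rep f = 0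

/-- The Zariski topology: the sets `{f ≠ 0}`, `f` homogeneous, are a basis of the open sets. -/
instance zariskiTopology : TopologicalSpace (PSpace K m) :=
  TopologicalSpace.generateFrom
    {U | ∃ (e : ℕ) (f : MvPolynomial (Fin (m + 1)) K), f.IsHomogeneous e ∧
      U = {P | ¬ VanishesAt f P}}

/-- The homogeneous ideal of `X`, generated by the homogeneous polynomials vanishing on `X`. -/
def homogIdeal (X : Set (PSpace K m)) : Ideal (MvPolynomial (Fin (m + 1)) K) :=
  Ideal.span {f | (∃ e : ℕ, f.IsHomogeneous e) ∧ ∀ P ∈ X, VanishesAt f P}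

/-- The tangent space at (a coordinate vector of) `P` of the affine cone over `X`: the kernel of
the Jacobian matrix of the polynomials in the homogeneous ideal of `X`. -/
def coneTangent (X : Set (PSpace K m)) (P : PSpace K m) : Submodule K (Fin (m + 1) → K) :=
  ⨅ f ∈ homogIdeal X, LinearMap.ker
    (∑ i, MvPolynomial.eval P.rep (MvPolynomial.pderiv i f) •
      (LinearMap.proj i : (Fin (m + 1) → K) →ₗ[K] K))

/-- `X ⊆ ℙ^m` is a smooth irreducible projective variety of dimension `d`. The dimension is the
Krull dimension of the homogeneous coordinate ring minus one, and smoothness is the Jacobian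
criterion: the Jacobian matrix has rank `m - d`, i.e. nullity `d + 1`, at every point. -/
structure IsSmoothProjectiveVariety (d : ℕ) (X : Set (PSpace K m)) : Prop where
  isClosed : IsClosed X
  isIrreducible : IsIrreducible X
  dim_eq : ringKrullDim (MvPolynomial (Fin (m + 1)) K ⧸ homogIdeal X) = (d + 1 : ℕ)
  smooth : ∀ P ∈ X, Module.finrank K (coneTangent X P) = d + 1

/-- The function `f` is regular on the open subset `U` of `X`: locally it is a quotient of two
homogeneous polynomials of the same degree. Values of `f` outside `U` are irrelevant. -/
def RegularOn {X : Set (PSpace K m)} (U : Set X) (f : X → K) : Prop :=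
  ∀ x ∈ U, ∃ N : Set X, IsOpen N ∧ x ∈ N ∧
    ∃ (e : ℕ) (a b : MvPolynomial (Fin (m + 1)) K), a.IsHomogeneous e ∧ b.IsHomogeneous e ∧
      ∀ y ∈ N ∩ U, ¬ VanishesAt b y.1 ∧
        f y = MvPolynomial.eval y.1.rep a / MvPolynomial.eval y.1.rep b

/-- Morphisms of varieties: continuous maps that pull regular functions back to such. -/
structure IsMorphism {X : Set (PSpace K m)} {Y : Set (PSpace K m')} (φ : X → Y) : Prop where
  continuous : Continuous φ
  regular : ∀ (V : Set Y) (f : Y → K), IsOpen V → RegularOn V f → RegularOn (φ ⁻¹' V) (f ∘ φ)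

theorem IsMorphism.id (X : Set (PSpace K m)) : IsMorphism (fun x : X => x) :=
  ⟨continuous_id, fun _ _ _ h => h⟩

theorem IsMorphism.comp {m'' : ℕ} {X : Set (PSpace K m)} {Y : Set (PSpace K m')}
    {Z : Set (PSpace K m'')} {ψ : Y → Z} {φ : X → Y} (hψ : IsMorphism ψ) (hφ : IsMorphism φ) :
    IsMorphism (fun x => ψ (φ x)) :=
  ⟨hψ.continuous.comp hφ.continuous, fun V f hV hf =>
    hφ.regular (ψ ⁻¹' V) (f ∘ ψ) (hV.preimage hψ.continuous) (hψ.regular V f hV hf)⟩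

/-- The group `Aut(X)` of regular automorphisms of `X`. -/
def autGroup (X : Set (PSpace K m)) : Subgroup (Equiv.Perm X) where
  carrier := {g | IsMorphism (fun x => g x) ∧ IsMorphism (fun x => g.symm x)}
  one_mem' := ⟨IsMorphism.id X, IsMorphism.id X⟩
  mul_mem' := fun ha hb => ⟨ha.1.comp hb.1, hb.2.comp ha.2⟩
  inv_mem' := fun ha => ⟨ha.2, ha.1⟩

/-! ## Galois covers and generalized Fermat pairs -/

/-- `π : X → Y` is a Galois (branched) cover with deck group `H`: the finite group `H` consists of
all automorphisms of `X` over `Y`, and `π` is the quotient morphism `X → X / H`, i.e. `π` is onto,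
its fibres are the `H`-orbits, `Y` has the quotient topology and the regular functions on `Y` are
those whose pullback is regular on `X`. -/
structure IsGaloisCover {X : Set (PSpace K m)} {Y : Set (PSpace K m')}
    (H : Subgroup (Equiv.Perm X)) (π : X → Y) : Prop where
  isMorphism : IsMorphism π
  finite : Finite H
  mem_iff : ∀ g : Equiv.Perm X, g ∈ H ↔ g ∈ autGroup X ∧ ∀ x, π (g x) = π x
  surjective : Function.Surjective π
  fibre : ∀ x y, π x = π y → ∃ h ∈ H, h x = y
  isOpen : ∀ V : Set Y, IsOpen (π ⁻¹' V) → IsOpen V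
  regular : ∀ (V : Set Y) (f : Y → K), IsOpen V → RegularOn (π ⁻¹' V) (f ∘ π) → RegularOn V f

/-- The ramification locus: the points with non-trivial stabilizer. -/
def ramificationLocus {X : Set (PSpace K m)} (H : Subgroup (Equiv.Perm X)) : Set X :=
  {x | ∃ h ∈ H, h ≠ 1 ∧ h x = x}

/-- The inertia group of a subset `T` of `X`: the elements of `H` fixing `T` pointwise. -/
def inertia {X : Set (PSpace K m)} (H : Subgroup (Equiv.Perm X)) (T : Set X) :
    Subgroup (Equiv.Perm X) where
  carrier := {h | h ∈ H ∧ ∀ x ∈ T, h x = x}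
  one_mem' := ⟨H.one_mem, fun _ _ => rfl⟩
  mul_mem' := fun {a b} ha hb => ⟨H.mul_mem ha.1 hb.1, fun x hx => by
    rw [Equiv.Perm.mul_apply, hb.2 x hx, ha.2 x hx]⟩
  inv_mem' := fun {a} ha => ⟨H.inv_mem ha.1, fun x hx => by
    rw [Equiv.Perm.inv_eq_iff_eq, ha.2 x hx]⟩

/-- The cover `π` has branch order `k` over the irreducible closed subset `S` of `Y`: every
irreducible component of `π⁻¹(S)` has inertia group of order `k`. -/
def HasBranchOrder {X : Set (PSpace K m)} {Y : Set (PSpace K m')}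
    (H : Subgroup (Equiv.Perm X)) (π : X → Y) (S : Set Y) (k : ℕ) : Prop :=
  ∀ T : Set X, Maximal (fun T' => IsIrreducible T' ∧ T' ⊆ π ⁻¹' S) T →
    Nat.card (inertia H T) = k

/-- The projective space `ℙ^d`, as a variety. -/
abbrev fullSpace (K : Type*) [Field K] (d : ℕ) : Set (PSpace K d) := Set.univ

/-- The hyperplane `ρ_1 x_1 + ⋯ + ρ_{d+1} x_{d+1} = 0`. -/
def hyperplane {d : ℕ} (ρ : Fin (d + 1) → K) : Set (fullSpace K d) :=
  {P | ∑ l, ρ l * P.1.rep l = 0}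

/-- The hyperplanes with coefficient vectors `ρ_j` are in general position: any `s ≤ d + 1` of
them meet in a plane of (projective) dimension `d - s`, i.e. their equations cut out a linear
subspace of `K^(d+1)` of dimension `d + 1 - s`. The cases `s = 1`, `s = 2` say that each `ρ_j`
defines a hyperplane and that the hyperplanes are pairwise different. -/
def GeneralPosition {d N : ℕ} (ρ : Fin N → Fin (d + 1) → K) : Prop :=
  ∀ S : Finset (Fin N), S.card ≤ d + 1 →
    Module.finrank K
      (⨅ j ∈ S, LinearMap.ker
        (∑ l, ρ j l • (LinearMap.proj l : (Fin (d + 1) → K) →ₗ[K] K)) :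
          Submodule K (Fin (d + 1) → K)) + S.card = d + 1

/-- The smooth irreducible projective variety `X` of dimension `d`, the group
`(ℤ/k)^n ≅ H < Aut(X)` and the map `π : X → ℙ^d` form a Galois branched cover with deck group `H`
whose branch divisor consists of the `n + 1` hyperplanes with coefficient vectors `ρ_j`, which are
in general position, each of branch order `k`. -/
structure IsGeneralizedFermatCover (d k n : ℕ) (X : Set (PSpace K m))
    (H : Subgroup (Equiv.Perm X)) (π : X → fullSpace K d)
    (ρ : Fin (n + 1) → Fin (d + 1) → K) : Prop where
  variety : IsSmoothProjectiveVariety d X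
  group_le : H ≤ autGroup X
  group_iso : Nonempty (H ≃* Multiplicative (Fin n → ZMod k))
  cover : IsGaloisCover H π
  generalPosition : GeneralPosition ρ
  branchLocus : π '' ramificationLocus H = ⋃ j, hyperplane (ρ j)
  branchOrder : ∀ j, HasBranchOrder H π (hyperplane (ρ j)) k

/-- `(X, H)` is a generalized Fermat pair of type `(d; k, n)`. -/
def IsGeneralizedFermatPair (d k n : ℕ) (X : Set (PSpace K m))
    (H : Subgroup (Equiv.Perm X)) : Prop :=
  1 ≤ d ∧ d + 1 ≤ n ∧ 2 ≤ k ∧ (k : K) ≠ 0 ∧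
    ∃ (π : X → fullSpace K d) (ρ : Fin (n + 1) → Fin (d + 1) → K),
      IsGeneralizedFermatCover d k n X H π ρ

/-! ## The algebraic models -/

section Model

variable {d n : ℕ}

/-- The coefficient vector of the hyperplane `Σ_{j+1}(Λ)` (`j` counts from `0`): the unit vectors
for `j ≤ d`, the vector `(1, …, 1)` for `j = d + 1`, and `(λ_{i,1}, …, λ_{i,d}, 1)` for the later
ones. -/
def sigmaCoeff (Λ : Fin (n - d - 1) → Fin d → K) (j : Fin (n + 1)) : Fin (d + 1) → K :=
  if h : (j : ℕ) ≤ d then fun l => if (l : ℕ) = j then 1 else 0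
  else if h' : (j : ℕ) = d + 1 then fun _ => 1
  else Fin.snoc (Λ ⟨(j : ℕ) - (d + 2), by omega⟩) 1

/-- The parameter space `X_{n,d}`: the hyperplanes `Σ_1(Λ), …, Σ_{n+1}(Λ)` are in general
position. -/
def paramSpace (K : Type*) [Field K] (n d : ℕ) : Set (Fin (n - d - 1) → Fin d → K) :=
  {Λ | GeneralPosition (sigmaCoeff Λ)}

/-- The coordinate vector `v` satisfies the equations
`λ_{i,1} x_1^k + ⋯ + λ_{i,d} x_d^k + x_{d+1}^k + x_{d+2+i}^k = 0`, `i = 0, …, n - d - 1`, where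
`λ_{0,1} = ⋯ = λ_{0,d} = 1`. -/
def ModelEquations (hn : d + 1 ≤ n) (k : ℕ) (Λ : Fin (n - d - 1) → Fin d → K)
    (v : Fin (n + 1) → K) : Prop :=
  ∀ j : Fin (n + 1), d + 1 ≤ (j : ℕ) →
    ∑ l : Fin (d + 1), sigmaCoeff Λ j l * v (Fin.castLE (by omega) l) ^ k + v j ^ k = 0

/-- The variety `X_n^k(Λ) ⊆ ℙ^n`. -/
def model (hn : d + 1 ≤ n) (k : ℕ) (Λ : Fin (n - d - 1) → Fin d → K) : Set (PSpace K n) :=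
  {P | ModelEquations hn k Λ P.rep}

theorem modelEquations_smul_iff (hn : d + 1 ≤ n) (k : ℕ) (Λ : Fin (n - d - 1) → Fin d → K)
    (c : Kˣ) (v : Fin (n + 1) → K) :
    ModelEquations hn k Λ (c • v) ↔ ModelEquations hn k Λ v := by
  unfold ModelEquations
  refine forall₂_congr fun j _ => ?_
  have h : ∑ l : Fin (d + 1), sigmaCoeff Λ j l * (c • v) (Fin.castLE (by omega) l) ^ k
      + (c • v) j ^ k = (c : K) ^ k *
        (∑ l : Fin (d + 1), sigmaCoeff Λ j l * v (Fin.castLE (by omega) l) ^ k + v j ^ k) := by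
    simp only [Pi.smul_apply, Units.smul_def, smul_eq_mul, mul_pow, mul_add, Finset.mul_sum]
    congr 1
    exact Finset.sum_congr rfl fun l _ => by ring
  rw [h, mul_eq_zero]
  simp [pow_ne_zero k c.ne_zero]

theorem mk_mem_model_iff (hn : d + 1 ≤ n) (k : ℕ) (Λ : Fin (n - d - 1) → Fin d → K)
    (v : Fin (n + 1) → K) (hv : v ≠ 0) :
    Projectivization.mk K v hv ∈ model hn k Λ ↔ ModelEquations hn k Λ v := by
  obtain ⟨a, ha⟩ := Projectivization.exists_smul_eq_mk_rep K v hv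
  change ModelEquations hn k Λ (Projectivization.mk K v hv).rep ↔ _
  rw [← ha, modelEquations_smul_iff]

/-- Multiplication of the `j`-th coordinate by `ω`. -/
def scaleCoord (ω : Kˣ) (j : Fin (n + 1)) : (Fin (n + 1) → K) ≃ₗ[K] (Fin (n + 1) → K) :=
  LinearEquiv.piCongrRight fun i => LinearEquiv.smulOfUnit (if i = j then ω else 1)

theorem scaleCoord_apply (ω : Kˣ) (j : Fin (n + 1)) (v : Fin (n + 1) → K) (i : Fin (n + 1)) :
    scaleCoord ω j v i = (if i = j then (ω : K) else 1) * v i := by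
  unfold scaleCoord
  split_ifs with h <;>
    simp [LinearEquiv.piCongrRight, LinearEquiv.smulOfUnit, h, Units.smul_def]

theorem modelEquations_scaleCoord_iff (hn : d + 1 ≤ n) {k : ℕ}
    (Λ : Fin (n - d - 1) → Fin d → K) {ω : Kˣ} (hω : ω ^ k = 1) (j : Fin (n + 1))
    (v : Fin (n + 1) → K) :
    ModelEquations hn k Λ (scaleCoord ω j v) ↔ ModelEquations hn k Λ v := by
  have hω' : (ω : K) ^ k = 1 := by rw [← Units.val_pow_eq_pow_val, hω, Units.val_one]
  have h : ∀ i, scaleCoord ω j v i ^ k = v i ^ k := fun i => by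
    rw [scaleCoord_apply, mul_pow]
    split_ifs <;> simp [hω']
  simp only [ModelEquations, h]

theorem scaleCoord_smul_mem_iff (hn : d + 1 ≤ n) {k : ℕ}
    (Λ : Fin (n - d - 1) → Fin d → K) {ω : Kˣ} (hω : ω ^ k = 1) (j : Fin (n + 1))
    (P : PSpace K n) :
    scaleCoord ω j • P ∈ model hn k Λ ↔ P ∈ model hn k Λ := by
  induction P using Projectivization.ind with
  | h v hv =>
    rw [Projectivization.smul_mk, mk_mem_model_iff, mk_mem_model_iff]
    exact modelEquations_scaleCoord_iff hn Λ hω j v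

/-- The automorphism `φ_j : [x_1 : ⋯ : x_j : ⋯ : x_{n+1}] ↦ [x_1 : ⋯ : ω x_j : ⋯ : x_{n+1}]` of
`X_n^k(Λ)`. -/
def phi (hn : d + 1 ≤ n) {k : ℕ} (Λ : Fin (n - d - 1) → Fin d → K) {ω : Kˣ} (hω : ω ^ k = 1)
    (j : Fin (n + 1)) : Equiv.Perm (model hn k Λ) :=
  (MulAction.toPerm (scaleCoord ω j) : Equiv.Perm (PSpace K n)).subtypePerm
    fun P => scaleCoord_smul_mem_iff hn Λ hω j P

/-- The group `H_0 = ⟨φ_1, …, φ_{n+1}⟩`. -/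
def groupH0 (hn : d + 1 ≤ n) {k : ℕ} (Λ : Fin (n - d - 1) → Fin d → K) {ω : Kˣ}
    (hω : ω ^ k = 1) : Subgroup (Equiv.Perm (model hn k Λ)) :=
  Subgroup.closure (Set.range (phi hn Λ hω))

theorem powers_ne_zero (hn : d + 1 ≤ n) {k : ℕ} (hk : 2 ≤ k) (Λ : Fin (n - d - 1) → Fin d → K)
    {v : Fin (n + 1) → K} (hv : v ≠ 0) (h : ModelEquations hn k Λ v) :
    (fun l : Fin (d + 1) => v (Fin.castLE (by omega) l) ^ k) ≠ 0 := by
  intro h0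
  have hk0 : k ≠ 0 := by omega
  have h1 : ∀ l : Fin (d + 1), v (Fin.castLE (by omega) l) ^ k = 0 := fun l => congrFun h0 l
  apply hv
  funext j
  by_cases hj : (j : ℕ) < d + 1
  · exact pow_eq_zero_iff hk0 |>.mp (h1 ⟨j, hj⟩)
  · have h2 := h j (by omega)
    simp only [h1, mul_zero, Finset.sum_const_zero, zero_add] at h2
    exact pow_eq_zero_iff hk0 |>.mp h2

/-- The map `π_0 : X_n^k(Λ) → ℙ^d`, `[x_1 : ⋯ : x_{n+1}] ↦ [x_1^k : ⋯ : x_{d+1}^k]`. -/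
def powerMap (hn : d + 1 ≤ n) {k : ℕ} (hk : 2 ≤ k) (Λ : Fin (n - d - 1) → Fin d → K)
    (P : model hn k Λ) : fullSpace K d :=
  ⟨Projectivization.mk K (fun l : Fin (d + 1) => P.1.rep (Fin.castLE (by omega) l) ^ k)
    (powers_ne_zero hn hk Λ P.1.rep_nonzero P.2), trivial⟩

/-- The map does not depend on the choice of homogeneous coordinates. -/
theorem powerMap_mk (hn : d + 1 ≤ n) {k : ℕ} (hk : 2 ≤ k) (Λ : Fin (n - d - 1) → Fin d → K)
    (v : Fin (n + 1) → K) (hv : v ≠ 0) (h : ModelEquations hn k Λ v) :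
    (powerMap hn hk Λ ⟨Projectivization.mk K v hv, (mk_mem_model_iff hn k Λ v hv).2 h⟩).1 =
      Projectivization.mk K (fun l : Fin (d + 1) => v (Fin.castLE (by omega) l) ^ k)
        (powers_ne_zero hn hk Λ hv h) := by
  obtain ⟨a, ha⟩ := Projectivization.exists_smul_eq_mk_rep K v hv
  refine (Projectivization.mk_eq_mk_iff' K _ _ _ _).2 ⟨(a : K) ^ k, ?_⟩
  funext l
  simp only [← ha, Pi.smul_apply, Units.smul_def, smul_eq_mul, mul_pow]

end Model

end FermatPair

end

noncomputable section

namespace FermatPair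

/-! ## Homogeneous polynomials and the Zariski topology -/

section Zariski

variable {K : Type*} [Field K] {m : ℕ}

open MvPolynomial

/-! Put `B = K[y_1, …, y_{d+1}]` with `y_l = x_l ^ k`, and let `ℓ_j` be the linear form with `x_j ^
k = ℓ_j(y)` on the model (`rootCoeff`). Modulo the equations, every polynomial is a `B`-combination
of the monomials `∏ x_j ^ a_j` with `a_j < k`. General position makes the `ℓ_j` pairwise
non-associated primes of `B`, so by Kummer theory the corresponding products of `k`-th roots of the
`ℓ_j` are linearly independent over `Frac B` (`linearIndependent_prod_pow`). Hence the equations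
generate the kernel of a homomorphism into a field (`modelIdeal_eq_ker`). This ideal is prime, its
quotient is integral over `B` and so of dimension `d + 1`, and by the Nullstellensatz it is the
whole homogeneous ideal of the model.

Smoothness is a dimension count. At a point whose zero coordinates are indexed by `Z`, the tangent
space of the cone is the product of `K^Z` and the common kernel of the `ℓ_j`, `j ∈ Z`, which has
dimension `d + 1 - |Z|` by general position (`finrank_coneTangent_model`).

Two points with proportional `k`-th powers differ by a diagonal matrix of roots of unity, so the
fibres of `π_0` are the orbits of `H_0`. Summing over the diagonal matrices turns a polynomial on
the model into a polynomial in `y`, and since `k` is invertible this can be kept non-zero at a given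
point. Open sets and regular functions therefore descend. A deck transformation agrees at each point
with some diagonal matrix, and irreducibility makes the choice uniform.

A diagonal matrix fixes a point exactly when its entries agree on the non-zero coordinates. The
preimage of `Σ_j` is `{x_j = 0}`, and each of its components maps onto `Σ_j`. So each contains a
point with no other zero coordinate, and its inertia group consists of the scalings of `x_j`. -/

theorem aeval_mul_of_isHomogeneous {σ S : Type*} [CommRing S] [Algebra K S]
    {f : MvPolynomial σ K} {e : ℕ} (hf : f.IsHomogeneous e) (t : S) (x : σ → S) :
    aeval (fun i => t * x i) f = t ^ e * aeval x f := by
  rw [aeval_def, aeval_def, eval₂_eq, eval₂_eq, Finset.mul_sum]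
  refine Finset.sum_congr rfl fun s hs => ?_
  simp_rw [mul_pow, Finset.prod_mul_distrib, Finset.prod_pow_eq_pow_sum]
  rw [← show e = ∑ i ∈ s.support, s i from hf.degree_eq_sum_deg_support hs]
  ring

theorem eval_smul_of_isHomogeneous {σ : Type*} {f : MvPolynomial σ K} {e : ℕ}
    (hf : f.IsHomogeneous e) (t : K) (x : σ → K) : eval (t • x) f = t ^ e * eval x f :=
  aeval_mul_of_isHomogeneous hf t x

theorem vanishesAt_mk {f : MvPolynomial (Fin (m + 1)) K} {e : ℕ} (hf : f.IsHomogeneous e)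
    (v : Fin (m + 1) → K) (hv : v ≠ 0) :
    VanishesAt f (Projectivization.mk K v hv) ↔ eval v f = 0 := by
  obtain ⟨a, ha⟩ := Projectivization.exists_smul_eq_mk_rep K v hv
  rw [VanishesAt, ← ha, Units.smul_def, eval_smul_of_isHomogeneous hf]
  simp

/-- A polynomial vanishing on a punctured line through the origin has homogeneous components
vanishing there. -/
theorem eval_homogeneousComponent_eq_zero [Infinite K] {σ : Type*} (F : MvPolynomial σ K)
    (v : σ → K) (h : ∀ t : K, t ≠ 0 → eval (t • v) F = 0) (e : ℕ) :
    eval v (homogeneousComponent e F) = 0 := by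
  set q : Polynomial K := ∑ i ∈ Finset.range (F.totalDegree + 1),
    Polynomial.monomial i (eval v (homogeneousComponent i F)) with hq
  have hqe : ∀ t, q.eval t = eval (t • v) F := by
    intro t
    conv_rhs => rw [← sum_homogeneousComponent F]
    rw [hq, Polynomial.eval_finsetSum, map_sum]
    refine Finset.sum_congr rfl fun i _ => ?_
    rw [eval_smul_of_isHomogeneous (homogeneousComponent_isHomogeneous i F),
      Polynomial.eval_monomial, mul_comm]
  -- The factor `X` takes care of `t = 0`, about which the hypothesis says nothing.
  have hq0 : Polynomial.X * q = 0 := by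
    refine Polynomial.funext fun t => ?_
    by_cases ht : t = 0
    · simp [ht]
    · simp [hqe, h t ht]
  have hq1 : q = 0 := (mul_eq_zero.1 hq0).resolve_left Polynomial.X_ne_zero
  by_cases he : e < F.totalDegree + 1
  · have := congrArg (fun r => Polynomial.coeff r e) hq1
    simpa [hq, Polynomial.finsetSum_coeff, Polynomial.coeff_monomial, he] using this
  · rw [homogeneousComponent_eq_zero _ _ (by omega), map_zero]

theorem exists_homogeneousComponent_eval_ne_zero {σ : Type*} {F : MvPolynomial σ K} {v : σ → K}
    (h : eval v F ≠ 0) : ∃ e, eval v (homogeneousComponent e F) ≠ 0 := by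
  by_contra! hc
  apply h
  rw [← sum_homogeneousComponent F, map_sum]
  exact Finset.sum_eq_zero fun i _ => hc i

theorem isTopologicalBasis_nonvanishing :
    TopologicalSpace.IsTopologicalBasis
      {U : Set (PSpace K m) | ∃ (e : ℕ) (f : MvPolynomial (Fin (m + 1)) K), f.IsHomogeneous e ∧
        U = {P | ¬ VanishesAt f P}} := by
  refine TopologicalSpace.isTopologicalBasis_of_subbasis_of_finiteInter rfl ⟨?_, ?_⟩
  · exact ⟨0, 1, isHomogeneous_one _ _, by simp [VanishesAt]⟩
  · rintro _ ⟨e, f, hf, rfl⟩ _ ⟨e', g, hg, rfl⟩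
    refine ⟨e + e', f * g, hf.mul hg, ?_⟩
    ext P
    simp [VanishesAt]

theorem isOpen_nonvanishing {e : ℕ} {f : MvPolynomial (Fin (m + 1)) K} (hf : f.IsHomogeneous e) :
    IsOpen {P : PSpace K m | ¬ VanishesAt f P} :=
  TopologicalSpace.isOpen_generateFrom_of_mem ⟨e, f, hf, rfl⟩

theorem exists_nonvanishing_subset {U : Set (PSpace K m)} (hU : IsOpen U) {P : PSpace K m}
    (hP : P ∈ U) : ∃ (e : ℕ) (f : MvPolynomial (Fin (m + 1)) K), f.IsHomogeneous e ∧
      ¬ VanishesAt f P ∧ ∀ Q, ¬ VanishesAt f Q → Q ∈ U := by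
  obtain ⟨_, ⟨e, f, hf, rfl⟩, h1, h2⟩ :=
    isTopologicalBasis_nonvanishing.exists_subset_of_mem_open hP hU
  exact ⟨e, f, hf, h1, h2⟩

/-- A set of points is closed as soon as every point outside is separated from (the affine cone
over) it by a polynomial, homogeneous or not. -/
theorem isClosed_of_separated [Infinite K] {C : Set (PSpace K m)}
    (h : ∀ P ∉ C, ∃ F : MvPolynomial (Fin (m + 1)) K, eval P.rep F ≠ 0 ∧
      ∀ (v : Fin (m + 1) → K) (hv : v ≠ 0), Projectivization.mk K v hv ∈ C → eval v F = 0) :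
    IsClosed C := by
  rw [← isOpen_compl_iff, isOpen_iff_forall_mem_open]
  intro P hP
  obtain ⟨F, hF, hC⟩ := h P hP
  obtain ⟨e, he⟩ := exists_homogeneousComponent_eval_ne_zero hF
  refine ⟨_, ?_, isOpen_nonvanishing (homogeneousComponent_isHomogeneous e F), he⟩
  intro Q hQ hQC
  -- All non-zero multiples of `Q.rep` represent `Q`, so `F` vanishes on a punctured line and its
  -- homogeneous components vanish there too.
  refine hQ (eval_homogeneousComponent_eq_zero F Q.rep (fun t ht => ?_) e)
  refine hC _ (smul_ne_zero ht Q.rep_nonzero) ?_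
  rwa [show Projectivization.mk K (t • Q.rep) (smul_ne_zero ht Q.rep_nonzero) = Q from ?_]
  conv_rhs => rw [← Q.mk_rep]
  exact (Projectivization.mk_eq_mk_iff' K _ _ _ _).2 ⟨t, rfl⟩

theorem isIrreducible_of_mul {X : Set (PSpace K m)} (hne : X.Nonempty)
    (h : ∀ (e e' : ℕ) (f g : MvPolynomial (Fin (m + 1)) K), f.IsHomogeneous e →
      g.IsHomogeneous e' → (∃ P ∈ X, ¬ VanishesAt f P) → (∃ P ∈ X, ¬ VanishesAt g P) →
      ∃ P ∈ X, ¬ VanishesAt (f * g) P) : IsIrreducible X := by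
  refine ⟨hne, fun U V hU hV ⟨P, hPX, hPU⟩ ⟨Q, hQX, hQV⟩ => ?_⟩
  obtain ⟨e, f, hf, hfP, hfU⟩ := exists_nonvanishing_subset hU hPU
  obtain ⟨e', g, hg, hgQ, hgV⟩ := exists_nonvanishing_subset hV hQV
  obtain ⟨R, hRX, hR⟩ := h e e' f g hf hg ⟨P, hPX, hfP⟩ ⟨Q, hQX, hgQ⟩
  simp only [VanishesAt, map_mul, mul_eq_zero, not_or] at hR
  exact ⟨R, hRX, hfU R hR.1, hgV R hR.2⟩

/-- The homogeneous prime ideal of the point `P`. -/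
def pointIdeal (P : PSpace K m) : PrimeSpectrum (MvPolynomial (Fin (m + 1)) K) :=
  ⟨RingHom.ker (aeval (R := K) fun i => (Polynomial.X * Polynomial.C (P.rep i) : Polynomial K)),
    RingHom.ker_isPrime _⟩

theorem aeval_X_mul_rep_of_isHomogeneous {f : MvPolynomial (Fin (m + 1)) K} {e : ℕ}
    (hf : f.IsHomogeneous e) (P : PSpace K m) :
    aeval (fun i => (Polynomial.X * Polynomial.C (P.rep i) : Polynomial K)) f =
      Polynomial.monomial e (eval P.rep f) := by
  have h : aeval (fun i => (Polynomial.C (P.rep i) : Polynomial K)) f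
      = Polynomial.C (eval P.rep f) := aeval_algebraMap_apply (Polynomial K) P.rep f
  rw [aeval_mul_of_isHomogeneous hf, h, mul_comm, Polynomial.C_mul_X_pow_eq_monomial]

theorem mem_pointIdeal (f : MvPolynomial (Fin (m + 1)) K) (P : PSpace K m) :
    f ∈ (pointIdeal P).asIdeal ↔ ∀ e, VanishesAt (homogeneousComponent e f) P := by
  have h : aeval (fun i => (Polynomial.X * Polynomial.C (P.rep i) : Polynomial K)) f =
      ∑ e ∈ Finset.range (f.totalDegree + 1),
        Polynomial.monomial e (eval P.rep (homogeneousComponent e f)) := by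
    conv_lhs => rw [← sum_homogeneousComponent f, map_sum]
    exact Finset.sum_congr rfl fun e _ =>
      aeval_X_mul_rep_of_isHomogeneous (homogeneousComponent_isHomogeneous e f) P
  rw [pointIdeal, RingHom.mem_ker, h]
  refine ⟨fun h0 e => ?_, fun h0 => Finset.sum_eq_zero fun e _ => ?_⟩
  · by_cases he : e < f.totalDegree + 1
    · have := congrArg (fun r => Polynomial.coeff r e) h0
      simpa [VanishesAt, Polynomial.finsetSum_coeff, Polynomial.coeff_monomial, he] using this
    · rw [VanishesAt, homogeneousComponent_eq_zero _ _ (by omega), map_zero]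
  · rw [show eval P.rep (homogeneousComponent e f) = 0 from h0 e, Polynomial.monomial_zero_right]

/-- The kernels of the substitutions `x_i ↦ T · P_i` place projective space inside a Noetherian
spectrum. The purpose is Noetherianity, which later provides finitely many irreducible components.
-/
theorem isInducing_pointIdeal : Topology.IsInducing (pointIdeal : PSpace K m → _) := by
  refine ⟨le_antisymm ?_ ?_⟩
  · rw [← continuous_iff_le_induced]
    refine PrimeSpectrum.isTopologicalBasis_basic_opens.continuous_iff.2 ?_
    rintro _ ⟨f, rfl⟩
    have : pointIdeal ⁻¹' (PrimeSpectrum.basicOpen f : Set (PrimeSpectrum _)) =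
        ⋃ e, {P : PSpace K m | ¬ VanishesAt (homogeneousComponent e f) P} := by
      ext P
      simp [mem_pointIdeal]
    rw [this]
    exact isOpen_iUnion fun e => isOpen_nonvanishing (homogeneousComponent_isHomogeneous e f)
  · refine le_generateFrom ?_
    rintro _ ⟨e, f, hf, rfl⟩
    refine ⟨_, (PrimeSpectrum.basicOpen f).isOpen, ?_⟩
    ext P
    have h : f ∈ (pointIdeal P).asIdeal ↔ VanishesAt f P := by
      rw [pointIdeal, RingHom.mem_ker, aeval_X_mul_rep_of_isHomogeneous hf, VanishesAt]
      simp
    simp [h]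

instance : TopologicalSpace.NoetherianSpace (PSpace K m) :=
  isInducing_pointIdeal.noetherianSpace

end Zariski

/-! ## Kummer extensions of factorial domains -/

section Kummer

/-- Compare the multiplicities of `ℓ j` on both sides modulo `k`: the `k`-th powers drop out, and
exponents below `k` are determined by their residues. -/
theorem eq_of_pow_mul_prod_pow_eq {ι B : Type*} [Fintype ι] [CommRing B] [IsDomain B]
    [WfDvdMonoid B] {ℓ : ι → B} (hℓ : ∀ i, Prime (ℓ i))
    (hne : ∀ i j, i ≠ j → ¬ ℓ i ∣ ℓ j) {k : ℕ} {a b : ι → Fin k} {u v : B} (hu : u ≠ 0)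
    (hv : v ≠ 0)
    (h : v ^ k * ∏ i, ℓ i ^ (a i : ℕ) = u ^ k * ∏ i, ℓ i ^ (b i : ℕ)) : a = b := by
  classical
  funext j
  have key : ∀ (w : B) (c : ι → Fin k), w ≠ 0 →
      emultiplicity (ℓ j) (w ^ k * ∏ i, ℓ i ^ (c i : ℕ)) =
        ((k * multiplicity (ℓ j) w + c j : ℕ) : ℕ∞) := by
    intro w c hw
    rw [emultiplicity_mul (hℓ j), emultiplicity_pow (hℓ j),
      Finset.emultiplicity_prod (hℓ j), Finset.sum_eq_single j]
    · rw [emultiplicity_pow (hℓ j),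
        (FiniteMultiplicity.of_prime_left (hℓ j) hw).emultiplicity_eq_multiplicity,
        (FiniteMultiplicity.of_prime_left (hℓ j) (hℓ j).ne_zero).emultiplicity_eq_multiplicity]
      rw [multiplicity_self]
      push_cast
      ring
    · intro i _ hij
      rw [emultiplicity_pow (hℓ j), emultiplicity_eq_zero.2 (hne j i hij.symm), mul_zero]
    · simp
  have h1 := congrArg (emultiplicity (ℓ j)) h
  rw [key v a hv, key u b hu, Nat.cast_inj] at h1
  have h2 := congrArg (· % k) h1
  simp only [Nat.mul_add_mod, Nat.mod_eq_of_lt (a j).2, Nat.mod_eq_of_lt (b j).2] at h2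
  exact Fin.ext h2

/-- Radicals of pairwise non-associated primes generate a Kummer extension of full degree. -/
theorem linearIndependent_prod_pow {ι B F L : Type*} [Fintype ι] [CommRing B] [IsDomain B]
    [WfDvdMonoid B] [Field F] [Algebra B F] [IsFractionRing B F] [Field L] [Algebra F L]
    [IsGalois F L] {ℓ : ι → B} (hℓ : ∀ i, Prime (ℓ i)) (hne : ∀ i j, i ≠ j → ¬ ℓ i ∣ ℓ j)
    {k : ℕ} [NeZero k] {ζ : F} (hζ : IsPrimitiveRoot ζ k) {r : ι → L}
    (hr : ∀ i, r i ^ k = algebraMap F L (algebraMap B F (ℓ i))) :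
    LinearIndependent F fun a : ι → Fin k => ∏ i, r i ^ (a i : ℕ) := by
  classical
  set M : (ι → Fin k) → L := fun a => ∏ i, r i ^ (a i : ℕ) with hM
  have hr0 : ∀ i, r i ≠ 0 := fun i h0 => by
    have := hr i
    rw [h0, zero_pow (NeZero.ne k), eq_comm, map_eq_zero, IsFractionRing.to_map_eq_zero_iff] at this
    exact (hℓ i).ne_zero this
  have hM0 : ∀ a, M a ≠ 0 := fun a => Finset.prod_ne_zero_iff.2 fun i _ => pow_ne_zero _ (hr0 i)
  have hMk : ∀ a, M a ^ k = algebraMap F L (algebraMap B F (∏ i, ℓ i ^ (a i : ℕ))) := fun a => by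
    simp only [hM, map_prod, map_pow, ← Finset.prod_pow]
    exact Finset.prod_congr rfl fun i _ => by rw [← hr, ← pow_mul, ← pow_mul, mul_comm]
  have hζL := hζ.map_of_injective (algebraMap F L).injective
  -- ratios of conjugates are roots of unity of the base field
  have hfix : ∀ (σ τ : L ≃ₐ[F] L) (a : ι → Fin k), σ (τ (M a) / M a) = τ (M a) / M a := by
    intro σ τ a
    have h1 : (τ (M a) / M a) ^ k = 1 := by
      rw [div_pow, ← map_pow, hMk, AlgEquiv.commutes, ← hMk, div_self (pow_ne_zero _ (hM0 a))]
    obtain ⟨i, -, hi⟩ := hζL.eq_pow_of_pow_eq_one h1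
    rw [← hi, ← map_pow, AlgEquiv.commutes]
  -- The Kummer character of `M a`. It is multiplicative because its values are fixed by the Galois
  -- group.
  let χ : (ι → Fin k) → ((L ≃ₐ[F] L) →* L) := fun a =>
    { toFun := fun σ => σ (M a) / M a
      map_one' := by simp [hM0 a]
      map_mul' := fun σ τ => by
        have h2 : σ (τ (M a)) = σ (M a) * (τ (M a) / M a) := by
          conv_lhs => rw [← div_mul_cancel₀ (τ (M a)) (hM0 a), map_mul, hfix]
          ring
        rw [AlgEquiv.mul_apply, h2]
        ring }
  have hχ : Function.Injective χ := by
    intro a b hab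
    -- Equal characters make `M a / M b` Galois invariant, hence an element `u / v` of `F`. Its
    -- `k`-th power gives an identity in `B` to which unique factorization applies.
    have h3 : M a / M b ∈ Set.range (algebraMap F L) := by
      refine (InfiniteGalois.mem_range_algebraMap_iff_fixed (k := F) _).2 fun σ => ?_
      have := DFunLike.congr_fun hab σ
      change σ (M a) / M a = σ (M b) / M b at this
      have hσ : σ (M b) ≠ 0 := (map_ne_zero σ).2 (hM0 b)
      rw [map_div₀, div_eq_div_iff hσ (hM0 b)]
      rw [div_eq_div_iff (hM0 a) (hM0 b)] at this
      rw [this, mul_comm]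
    obtain ⟨c, hc⟩ := h3
    obtain ⟨u, v, hv, rfl⟩ := IsFractionRing.div_surjective (A := B) c
    have hv0 : v ≠ 0 := nonZeroDivisors.ne_zero hv
    have hu0 : u ≠ 0 := by
      rintro rfl
      rw [map_zero, zero_div, map_zero, eq_comm, div_eq_zero_iff] at hc
      exact hc.elim (hM0 a) (hM0 b)
    refine eq_of_pow_mul_prod_pow_eq hℓ hne hu0 hv0 ?_
    have hvF : algebraMap F L (algebraMap B F v) ≠ 0 := by
      simpa using hv0
    apply IsFractionRing.injective B F
    apply (algebraMap F L).injective
    rw [map_mul, map_mul, map_mul, map_mul, ← hMk, ← hMk]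
    rw [map_div₀, div_eq_div_iff hvF (hM0 b)] at hc
    simp only [map_pow]
    rw [← mul_pow, ← mul_pow, hc, mul_comm]
  rw [Fintype.linearIndependent_iff]
  intro c hc
  -- Dedekind independence of characters: applying every `σ` to `∑ c a • M a = 0` gives a relation
  -- between the `χ a` with coefficients `c a * M a`.
  have hli := (linearIndependent_monoidHom (L ≃ₐ[F] L) L).comp χ hχ
  rw [Fintype.linearIndependent_iff] at hli
  have h4 := hli (fun a => algebraMap F L (c a) * M a) ?_
  · intro a
    simpa [hM0 a] using h4 a
  · funext σ
    have h5 := congrArg σ hc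
    rw [map_sum, map_zero] at h5
    simp only [Finset.sum_apply, Pi.smul_apply, Function.comp_apply, Pi.zero_apply, smul_eq_mul]
    rw [← h5]
    refine Finset.sum_congr rfl fun a _ => ?_
    change algebraMap F L (c a) * M a * (σ (M a) / M a) = σ (c a • M a)
    rw [Algebra.smul_def, map_mul, AlgEquiv.commutes]
    field_simp [hM0 a]

end Kummer

/-- Incomparability gives `≤`. For `≥`, lying over lifts the smallest prime of a chain and going up
lifts the rest. -/
theorem ringKrullDim_eq_of_isIntegral_of_injective {R S : Type*} [CommRing R] [CommRing S]
    [Algebra R S] [Algebra.IsIntegral R S] (h : Function.Injective (algebraMap R S)) :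
    ringKrullDim S = ringKrullDim R := by
  refine le_antisymm (Order.krullDim_le_of_strictMono (PrimeSpectrum.comap (algebraMap R S))
    fun P Q hPQ => Ideal.IsIntegral.comap_lt_comap hPQ) ?_
  refine iSup_le fun l => ?_
  obtain ⟨Q, hQ, hQl⟩ := Ideal.exists_ideal_over_prime_of_isIntegral l.head.asIdeal (⊥ : Ideal S)
    (by rw [← RingHom.ker_eq_comap_bot, (RingHom.injective_iff_ker_eq_bot _).1 h]; exact bot_le)
  obtain ⟨hQp, hQl⟩ := hQl
  have : Q.LiesOver l.head.asIdeal := ⟨hQl.symm⟩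
  obtain ⟨L, hL, -⟩ := Ideal.exists_ltSeries_of_hasGoingUp l Q
  rw [← hL]
  exact le_iSup (fun p : LTSeries (PrimeSpectrum S) => (p.length : WithBot ℕ∞)) L

/-! ## Linear forms in general position -/

section LinearForms

open MvPolynomial

variable {K : Type*} [Field K] {d N : ℕ}

/-- The linear form with coefficient vector `ρ`. -/
def linForm (ρ : Fin (d + 1) → K) : (Fin (d + 1) → K) →ₗ[K] K :=
  ∑ l, ρ l • (LinearMap.proj l : (Fin (d + 1) → K) →ₗ[K] K)

theorem linForm_apply (ρ y : Fin (d + 1) → K) : linForm ρ y = ∑ l, ρ l * y l := by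
  simp [linForm]

theorem linForm_neg (ρ : Fin (d + 1) → K) : linForm (-ρ) = -linForm ρ := by
  ext; simp [linForm]

theorem GeneralPosition.finrank_add_card {ρ : Fin N → Fin (d + 1) → K} (h : GeneralPosition ρ)
    {S : Finset (Fin N)} (hS : S.card ≤ d + 1) :
    Module.finrank K (⨅ j ∈ S, LinearMap.ker (linForm (ρ j)) : Submodule K (Fin (d + 1) → K))
      + S.card = d + 1 := h S hS

theorem GeneralPosition.exists_linForm_ne_zero {ρ : Fin N → Fin (d + 1) → K}
    (h : GeneralPosition ρ) (i : Fin N) : ∃ y, linForm (ρ i) y ≠ 0 := by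
  by_contra! hc
  have h1 := h.finrank_add_card (S := {i}) (by simp)
  have h2 : LinearMap.ker (linForm (ρ i)) = ⊤ := by
    ext y; simp [hc y]
  have h3 : (⨅ j ∈ ({i} : Finset (Fin N)), LinearMap.ker (linForm (ρ j))) = ⊤ := by
    rw [Finset.iInf_singleton, h2]
  rw [h3, finrank_top] at h1
  simp at h1

/-- Otherwise one kernel contains the other, and the two forms cut out codimension one instead of
two. The bound `1 ≤ d` makes pairs admissible in general position. -/
theorem GeneralPosition.exists_linForm_eq_zero_ne_zero {ρ : Fin N → Fin (d + 1) → K}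
    (h : GeneralPosition ρ) (hd : 1 ≤ d) {i j : Fin N} (hij : i ≠ j) :
    ∃ y, linForm (ρ i) y = 0 ∧ linForm (ρ j) y ≠ 0 := by
  by_contra! hc
  have h1 := h.finrank_add_card (S := {i}) (by simp)
  have h2 := h.finrank_add_card (S := {i, j}) (by rw [Finset.card_pair hij]; omega)
  rw [Finset.card_pair hij] at h2
  have h3 : LinearMap.ker (linForm (ρ i)) ≤ LinearMap.ker (linForm (ρ j)) := fun y hy => hc y hy
  rw [Finset.iInf_singleton] at h1
  rw [Finset.iInf_insert, Finset.iInf_singleton, inf_eq_left.2 h3] at h2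
  rw [Finset.card_singleton] at h1
  omega

/-- The linear polynomial with coefficient vector `ρ`. -/
def linPoly (ρ : Fin (d + 1) → K) : MvPolynomial (Fin (d + 1)) K := ∑ l, C (ρ l) * X l

theorem eval_linPoly (ρ y : Fin (d + 1) → K) : eval y (linPoly ρ) = linForm ρ y := by
  simp [linPoly, linForm_apply]

theorem isHomogeneous_linPoly (ρ : Fin (d + 1) → K) : (linPoly ρ).IsHomogeneous 1 :=
  IsHomogeneous.sum _ _ _ fun _ _ => isHomogeneous_C_mul_X _ _

theorem linPoly_single (l : Fin (d + 1)) : linPoly (Pi.single l (1 : K)) = X l := by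
  rw [linPoly, Finset.sum_eq_single l]
  · simp
  · intro i _ hi; simp [hi]
  · simp

/-- Degree one forces irreducibility, since a constant dividing a non-zero coefficient is a unit;
factoriality then gives primality. -/
theorem prime_linPoly {ρ : Fin (d + 1) → K} {y : Fin (d + 1) → K} (hy : linForm ρ y ≠ 0) :
    Prime (linPoly ρ) := by
  have h0 : linPoly ρ ≠ 0 := fun h => hy (by rw [← eval_linPoly, h, map_zero])
  refine (irreducible_of_totalDegree_eq_one ((isHomogeneous_linPoly ρ).totalDegree h0)
    fun x hx => ?_).prime
  obtain ⟨s, hs⟩ := ne_zero_iff.1 h0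
  exact (ne_zero_of_dvd_ne_zero hs (hx s)).isUnit

end LinearForms

/-! ## The homogeneous ideal of the model -/

section ModelIdeal

open MvPolynomial

variable {K : Type*} [Field K] {d n : ℕ}

/-- Coefficients expressing the `k`-th powers of the coordinates on the model in terms of those
of the first `d + 1` coordinates. -/
def rootCoeff (Λ : Fin (n - d - 1) → Fin d → K) (j : Fin (n + 1)) : Fin (d + 1) → K :=
  if (j : ℕ) ≤ d then sigmaCoeff Λ j else -sigmaCoeff Λ j

theorem rootCoeff_castLE (hn : d + 1 ≤ n) (Λ : Fin (n - d - 1) → Fin d → K) (l : Fin (d + 1)) :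
    rootCoeff Λ (Fin.castLE (by omega) l) = Pi.single l 1 := by
  have h : (l : ℕ) ≤ d := by omega
  funext i
  simp [rootCoeff, sigmaCoeff, h, Pi.single_apply, Fin.ext_iff]

theorem ker_linForm_rootCoeff (Λ : Fin (n - d - 1) → Fin d → K) (j : Fin (n + 1)) :
    LinearMap.ker (linForm (rootCoeff Λ j)) = LinearMap.ker (linForm (sigmaCoeff Λ j)) := by
  by_cases h : (j : ℕ) ≤ d
  · rw [rootCoeff, if_pos h]
  · rw [rootCoeff, if_neg h]
    ext y
    simp [linForm_neg]

theorem linForm_rootCoeff_eq_zero_iff (Λ : Fin (n - d - 1) → Fin d → K) (j : Fin (n + 1))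
    (y : Fin (d + 1) → K) :
    linForm (rootCoeff Λ j) y = 0 ↔ linForm (sigmaCoeff Λ j) y = 0 := by
  rw [← LinearMap.mem_ker, ker_linForm_rootCoeff, LinearMap.mem_ker]

theorem generalPosition_rootCoeff {Λ : Fin (n - d - 1) → Fin d → K}
    (h : GeneralPosition (sigmaCoeff (n := n) Λ)) : GeneralPosition (rootCoeff (n := n) Λ) := by
  intro S hS
  change Module.finrank K (⨅ j ∈ S, LinearMap.ker (linForm (rootCoeff Λ j)) :
    Submodule K (Fin (d + 1) → K)) + S.card = d + 1
  rw [iInf_congr fun j => iInf_congr fun _ => ker_linForm_rootCoeff Λ j]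
  exact h.finrank_add_card hS

/-- The `k`-th powers of the first `d + 1` coordinates. -/
def basePow (hn : d + 1 ≤ n) (k : ℕ) (v : Fin (n + 1) → K) : Fin (d + 1) → K :=
  fun l => v (Fin.castLE (by omega) l) ^ k

/-- For `j ≤ d` the equation added here is a tautology (and `modelPoly` is zero), so that all `n +
1` coordinates can be treated alike, as `k`-th roots of linear forms. -/
theorem modelEquations_iff (hn : d + 1 ≤ n) (k : ℕ) (Λ : Fin (n - d - 1) → Fin d → K)
    (v : Fin (n + 1) → K) :
    ModelEquations hn k Λ v ↔ ∀ j, v j ^ k = linForm (rootCoeff Λ j) (basePow hn k v) := by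
  constructor
  · intro h j
    by_cases hj : (j : ℕ) ≤ d
    · have hj' : j = Fin.castLE (by omega) (⟨j, by omega⟩ : Fin (d + 1)) := by ext; simp
      rw [hj', rootCoeff_castLE hn, linForm_apply]
      simp [Pi.single_apply, basePow]
    · have := h j (by omega)
      rw [rootCoeff, if_neg hj, linForm_neg, LinearMap.neg_apply, linForm_apply]
      exact eq_neg_of_add_eq_zero_right this
  · intro h j hj
    have := h j
    rw [rootCoeff, if_neg (by omega), linForm_neg, LinearMap.neg_apply, linForm_apply] at this
    rw [this]
    exact add_neg_cancel _

/-- The inclusion of the polynomial ring in `y_l = x_l ^ k`. -/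
def powHom (K : Type*) [Field K] (hn : d + 1 ≤ n) (k : ℕ) :
    MvPolynomial (Fin (d + 1)) K →ₐ[K] MvPolynomial (Fin (n + 1)) K :=
  aeval fun l => X (Fin.castLE (by omega) l) ^ k

theorem eval_powHom (hn : d + 1 ≤ n) (k : ℕ) (v : Fin (n + 1) → K)
    (f : MvPolynomial (Fin (d + 1)) K) : eval v (powHom K hn k f) = eval (basePow hn k v) f := by
  have : (eval v).comp (powHom K hn k : MvPolynomial (Fin (d + 1)) K →+* _) =
      eval (basePow hn k v) := by
    ext <;> simp [powHom, basePow]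
  exact RingHom.congr_fun this f

theorem isHomogeneous_powHom (hn : d + 1 ≤ n) (k : ℕ) {f : MvPolynomial (Fin (d + 1)) K} {e : ℕ}
    (hf : f.IsHomogeneous e) : (powHom K hn k f).IsHomogeneous (k * e) :=
  hf.aeval _ fun _ => isHomogeneous_X_pow _ _

/-- The equations of the model. -/
def modelPoly (hn : d + 1 ≤ n) (k : ℕ) (Λ : Fin (n - d - 1) → Fin d → K) (j : Fin (n + 1)) :
    MvPolynomial (Fin (n + 1)) K :=
  X j ^ k - powHom K hn k (linPoly (rootCoeff Λ j))

theorem eval_modelPoly (hn : d + 1 ≤ n) (k : ℕ) (Λ : Fin (n - d - 1) → Fin d → K)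
    (j : Fin (n + 1)) (v : Fin (n + 1) → K) : eval v (modelPoly hn k Λ j) =
      v j ^ k - linForm (rootCoeff Λ j) (basePow hn k v) := by
  simp [modelPoly, eval_powHom, eval_linPoly]

theorem isHomogeneous_modelPoly (hn : d + 1 ≤ n) (k : ℕ) (Λ : Fin (n - d - 1) → Fin d → K)
    (j : Fin (n + 1)) : (modelPoly hn k Λ j).IsHomogeneous k := by
  refine (isHomogeneous_X_pow _ _).sub ?_
  simpa using isHomogeneous_powHom hn k (isHomogeneous_linPoly (rootCoeff Λ j))

/-- The ideal generated by the equations of the model. -/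
def modelIdeal (hn : d + 1 ≤ n) (k : ℕ) (Λ : Fin (n - d - 1) → Fin d → K) :
    Ideal (MvPolynomial (Fin (n + 1)) K) :=
  Ideal.span (Set.range (modelPoly hn k Λ))

theorem mem_zeroLocus_modelIdeal (hn : d + 1 ≤ n) (k : ℕ) (Λ : Fin (n - d - 1) → Fin d → K)
    (v : Fin (n + 1) → K) : v ∈ zeroLocus K (modelIdeal hn k Λ) ↔ ModelEquations hn k Λ v := by
  rw [modelIdeal, zeroLocus_span, modelEquations_iff]
  simp only [Set.mem_ofPred_eq, Set.forall_mem_range]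
  refine forall_congr' fun j => ?_
  change eval v (modelPoly hn k Λ j) = 0 ↔ _
  rw [eval_modelPoly, sub_eq_zero]

theorem mk_X_pow (hn : d + 1 ≤ n) (k : ℕ) (Λ : Fin (n - d - 1) → Fin d → K) (j : Fin (n + 1)) :
    Ideal.Quotient.mk (modelIdeal hn k Λ) (X j) ^ k =
      Ideal.Quotient.mk (modelIdeal hn k Λ) (powHom K hn k (linPoly (rootCoeff Λ j))) := by
  rw [← map_pow, Ideal.Quotient.eq]
  exact Ideal.subset_span ⟨j, rfl⟩

/-- Modulo the equations of the model, every polynomial is a combination of the monomials with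
exponents less than `k`, with coefficients in the `k`-th powers of the first coordinates. -/
theorem exists_normalForm (hn : d + 1 ≤ n) (k : ℕ) [NeZero k] (Λ : Fin (n - d - 1) → Fin d → K)
    (f : MvPolynomial (Fin (n + 1)) K) :
    ∃ c : (Fin (n + 1) → Fin k) → MvPolynomial (Fin (d + 1)) K,
      Ideal.Quotient.mk (modelIdeal hn k Λ) f = Ideal.Quotient.mk (modelIdeal hn k Λ)
        (∑ a, powHom K hn k (c a) * ∏ j, X j ^ (a j : ℕ)) := by
  classical
  induction f using MvPolynomial.induction_on' with
  | monomial m u =>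
    -- Divide each exponent by `k`: the quotient becomes a power of the linear form and the
    -- remainder selects the monomial.
    refine ⟨Pi.single (fun j => Fin.ofNat k (m j))
      (C u * ∏ j, linPoly (rootCoeff Λ j) ^ (m j / k)), ?_⟩
    rw [Finset.sum_eq_single (fun j => Fin.ofNat k (m j))
        (fun a _ ha => by rw [Pi.single_eq_of_ne ha, map_zero, zero_mul]) (by simp),
      Pi.single_eq_same, monomial_eq, Finsupp.prod_fintype _ _ (fun _ => pow_zero _)]
    simp only [map_mul, map_prod, map_pow, mul_assoc, ← Finset.prod_mul_distrib]
    congr 1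
    · simp [powHom]
    · refine Finset.prod_congr rfl fun j _ => ?_
      rw [← mk_X_pow, ← pow_mul, ← pow_add]
      simp [Nat.div_add_mod]
  | add p q hp hq =>
    obtain ⟨c, hc⟩ := hp
    obtain ⟨c', hc'⟩ := hq
    refine ⟨c + c', ?_⟩
    rw [map_add, hc, hc', ← map_add, ← Finset.sum_add_distrib]
    simp only [Pi.add_apply, map_add, add_mul]

/-- Sending `x_j` to `r j` kills the equations. Conversely, the normal form of an element of the
kernel is a relation between linearly independent products of the `r j`, so all its coefficients
vanish. Injectivity holds because the composite into `L` is the inclusion of the polynomial ring. -/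
theorem modelIdeal_eq_ker (hd : 1 ≤ d) (hn : d + 1 ≤ n) {k : ℕ} [NeZero k]
    {Λ : Fin (n - d - 1) → Fin d → K} (hΛ : GeneralPosition (sigmaCoeff (n := n) Λ))
    {ω : K} (hω : IsPrimitiveRoot ω k) {F L : Type*} [Field F]
    [Algebra (MvPolynomial (Fin (d + 1)) K) F] [IsFractionRing (MvPolynomial (Fin (d + 1)) K) F]
    [Field L] [Algebra F L] [IsGalois F L] {r : Fin (n + 1) → L}
    (hr : ∀ j, r j ^ k = algebraMap F L (algebraMap _ F (linPoly (rootCoeff Λ j)))) :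
    modelIdeal hn k Λ = RingHom.ker (eval₂Hom ((algebraMap F L).comp
        ((algebraMap (MvPolynomial (Fin (d + 1)) K) F).comp C)) r)
      ∧ Function.Injective ((Ideal.Quotient.mk (modelIdeal hn k Λ)).comp
        (powHom K hn k : MvPolynomial (Fin (d + 1)) K →+* _)) := by
  set Φ := eval₂Hom ((algebraMap F L).comp
    ((algebraMap (MvPolynomial (Fin (d + 1)) K) F).comp C)) r with hΦ
  have hgp := generalPosition_rootCoeff hΛ
  have hΦp : ∀ f, Φ (powHom K hn k f) = algebraMap F L (algebraMap _ F f) := by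
    intro f
    have : Φ.comp (powHom K hn k : MvPolynomial (Fin (d + 1)) K →+* _) =
        (algebraMap F L).comp (algebraMap _ F) := by
      ext l
      · simp [powHom, hΦ]
      · have := hr (Fin.castLE (by omega) l)
        rw [rootCoeff_castLE hn, linPoly_single] at this
        simp [powHom, hΦ, this]
    exact RingHom.congr_fun this f
  have hle : modelIdeal hn k Λ ≤ RingHom.ker Φ := by
    rw [modelIdeal, Ideal.span_le]
    rintro _ ⟨j, rfl⟩
    change Φ (modelPoly hn k Λ j) = 0
    rw [modelPoly, map_sub, hΦp, ← hr, map_pow, hΦ, coe_eval₂Hom, eval₂_X, sub_self]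
  have hinj : Function.Injective fun f => algebraMap F L (algebraMap _ F f) :=
    (algebraMap F L).injective.comp (IsFractionRing.injective (MvPolynomial (Fin (d + 1)) K) F)
  refine ⟨le_antisymm hle fun f hf => ?_, fun f g hfg => ?_⟩
  · have hζ : IsPrimitiveRoot (algebraMap (MvPolynomial (Fin (d + 1)) K) F (C ω)) k :=
      hω.map_of_injective (f := (algebraMap (MvPolynomial (Fin (d + 1)) K) F).comp C)
        ((IsFractionRing.injective _ F).comp (C_injective _ _))
    have hli := linearIndependent_prod_pow (F := F) (L := L)
      (ℓ := fun j => linPoly (rootCoeff Λ j))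
      (fun j => prime_linPoly (hgp.exists_linForm_ne_zero j).choose_spec)
      (fun i j hij ⟨g, hg⟩ => by
        obtain ⟨y, hy, hy'⟩ := hgp.exists_linForm_eq_zero_ne_zero hd hij
        apply hy'
        rw [← eval_linPoly, hg, map_mul, eval_linPoly, hy, zero_mul]) hζ hr
    obtain ⟨c, hc⟩ := exists_normalForm hn k Λ f
    have h1 := hle (Ideal.Quotient.eq.1 hc)
    rw [RingHom.mem_ker, map_sub, RingHom.mem_ker.1 hf, zero_sub, neg_eq_zero, map_sum] at h1
    rw [Fintype.linearIndependent_iff] at hli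
    have h2 := hli (fun a => algebraMap _ F (c a)) (by
      rw [← h1]
      refine Finset.sum_congr rfl fun a _ => ?_
      rw [map_mul, hΦp, Algebra.smul_def, map_prod]
      simp [hΦ])
    have h3 : ∀ a, c a = 0 := fun a => by simpa using h2 a
    rw [← Ideal.Quotient.eq_zero_iff_mem, hc]
    simp [h3]
  · have h1 := hle (Ideal.Quotient.eq.1 hfg)
    rw [RingHom.mem_ker, map_sub, sub_eq_zero] at h1
    exact hinj ((hΦp f).symm.trans (h1.trans (hΦp g)))

/-- A separable closure is Galois over the fraction field and contains `k`-th roots of all the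
linear forms, because `k` is non-zero in it. -/
theorem modelIdeal_isPrime_and_injective (hd : 1 ≤ d) (hn : d + 1 ≤ n) {k : ℕ} [NeZero (k : K)]
    {Λ : Fin (n - d - 1) → Fin d → K} (hΛ : GeneralPosition (sigmaCoeff (n := n) Λ))
    {ω : K} (hω : IsPrimitiveRoot ω k) :
    (modelIdeal hn k Λ).IsPrime ∧ Function.Injective ((Ideal.Quotient.mk (modelIdeal hn k Λ)).comp
        (powHom K hn k : MvPolynomial (Fin (d + 1)) K →+* _)) := by
  let F := FractionRing (MvPolynomial (Fin (d + 1)) K)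
  let L := SeparableClosure F
  have hk : NeZero k := NeZero.of_neZero_natCast K
  have hkL : NeZero (k : L) := by
    have := NeZero.nat_of_injective (n := k)
      (f := (algebraMap F L).comp ((algebraMap _ F).comp (C : K →+* MvPolynomial (Fin (d + 1)) K)))
      (RingHom.injective _)
    exact this
  choose r hr using fun j => IsSepClosed.exists_pow_nat_eq
    (algebraMap F L (algebraMap _ F (linPoly (rootCoeff (n := n) Λ j)))) k
  obtain ⟨h1, h2⟩ := modelIdeal_eq_ker hd hn hΛ hω hr
  exact ⟨h1 ▸ RingHom.ker_isPrime _, h2⟩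

theorem ringKrullDim_quotient_modelIdeal (hd : 1 ≤ d) (hn : d + 1 ≤ n) {k : ℕ} [NeZero (k : K)]
    {Λ : Fin (n - d - 1) → Fin d → K} (hΛ : GeneralPosition (sigmaCoeff (n := n) Λ))
    {ω : K} (hω : IsPrimitiveRoot ω k) :
    ringKrullDim (MvPolynomial (Fin (n + 1)) K ⧸ modelIdeal hn k Λ) = (d + 1 : ℕ) := by
  obtain ⟨-, hinj⟩ := modelIdeal_isPrime_and_injective hd hn hΛ hω
  have hk : NeZero k := NeZero.of_neZero_natCast K
  set φ := (Ideal.Quotient.mk (modelIdeal hn k Λ)).comp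
        (powHom K hn k : MvPolynomial (Fin (d + 1)) K →+* _) with hφ
  let := φ.toAlgebra
  have hX : ∀ j, IsIntegral (MvPolynomial (Fin (d + 1)) K)
      (Ideal.Quotient.mk (modelIdeal hn k Λ) (X j)) := fun j => by
    refine IsIntegral.of_pow (NeZero.pos k) ?_
    rw [mk_X_pow]
    exact isIntegral_algebraMap (x := linPoly (rootCoeff Λ j))
  have : Algebra.IsIntegral (MvPolynomial (Fin (d + 1)) K)
      (MvPolynomial (Fin (n + 1)) K ⧸ modelIdeal hn k Λ) := by
    refine ⟨fun x => ?_⟩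
    obtain ⟨f, rfl⟩ := Ideal.Quotient.mk_surjective x
    induction f using MvPolynomial.induction_on with
    | C a =>
      have : C a = powHom K hn k (C a) := by simp [powHom]
      rw [this]
      exact isIntegral_algebraMap (x := (C a : MvPolynomial (Fin (d + 1)) K))
    | add p q hp hq => rw [map_add]; exact hp.add hq
    | mul_X p j hp => rw [map_mul]; exact hp.mul (hX j)
  rw [ringKrullDim_eq_of_isIntegral_of_injective hinj, ringKrullDim_of_isNoetherianRing]
  simp

/-- The `k`-th roots of the values `ℓ_j(y)` can be chosen independently in each coordinate. -/
theorem exists_modelEquations [IsAlgClosed K] (hn : d + 1 ≤ n) {k : ℕ} (hk : k ≠ 0)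
    (Λ : Fin (n - d - 1) → Fin d → K) {y : Fin (d + 1) → K} (hy : y ≠ 0) :
    ∃ v : Fin (n + 1) → K, v ≠ 0 ∧ ModelEquations hn k Λ v ∧ basePow hn k v = y := by
  choose v hv using fun j : Fin (n + 1) =>
    IsAlgClosed.exists_pow_nat_eq (linForm (rootCoeff Λ j) y) (Nat.pos_of_ne_zero hk)
  have hb : basePow hn k v = y := by
    funext l
    rw [basePow, hv, rootCoeff_castLE hn, linForm_apply]
    simp [Pi.single_apply]
  refine ⟨v, ?_, ?_, hb⟩
  · rintro rfl
    apply hy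
    rw [← hb]
    funext l
    simp [basePow, hk]
  · rw [modelEquations_iff, hb]
    exact hv

theorem model_nonempty [IsAlgClosed K] (hn : d + 1 ≤ n) {k : ℕ} (hk : k ≠ 0)
    (Λ : Fin (n - d - 1) → Fin d → K) : (model hn k Λ).Nonempty := by
  obtain ⟨v, hv, h, -⟩ := exists_modelEquations hn hk Λ (y := 1) one_ne_zero
  exact ⟨_, (mk_mem_model_iff hn k Λ v hv).2 h⟩

theorem mem_modelIdeal_iff [IsAlgClosed K] (hn : d + 1 ≤ n) {k : ℕ} (hk : k ≠ 0)
    {Λ : Fin (n - d - 1) → Fin d → K} (hJ : (modelIdeal hn k Λ).IsPrime)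
    {f : MvPolynomial (Fin (n + 1)) K} {e : ℕ} (hf : f.IsHomogeneous e) :
    f ∈ modelIdeal hn k Λ ↔ ∀ P ∈ model hn k Λ, VanishesAt f P := by
  rw [← IsPrime.vanishingIdeal_zeroLocus (K := K) (modelIdeal hn k Λ)]
  constructor
  · exact fun h P hP => h P.rep ((mem_zeroLocus_modelIdeal hn k Λ _).2 hP)
  · intro h v hv
    rw [mem_zeroLocus_modelIdeal] at hv
    change eval v f = 0
    -- The origin lies on the affine zero locus but is no projective point. There `f` takes the
    -- value `0 ^ e * f(P)` for any `P` of the model, which is zero even if `e = 0`.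
    by_cases hv0 : v = 0
    · obtain ⟨P, hP⟩ := model_nonempty hn hk Λ
      have h1 := eval_smul_of_isHomogeneous hf 0 P.rep
      rw [zero_smul, show eval P.rep f = 0 from h P hP, mul_zero] at h1
      rwa [hv0]
    · rw [← vanishesAt_mk hf v hv0]
      exact h _ ((mk_mem_model_iff hn k Λ v hv0).2 hv)

theorem homogIdeal_model [IsAlgClosed K] (hn : d + 1 ≤ n) {k : ℕ} (hk : k ≠ 0)
    {Λ : Fin (n - d - 1) → Fin d → K} (hJ : (modelIdeal hn k Λ).IsPrime) :
    homogIdeal (model hn k Λ) = modelIdeal hn k Λ := by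
  refine le_antisymm (Ideal.span_le.2 ?_) (Ideal.span_le.2 ?_)
  · rintro f ⟨⟨e, hf⟩, h⟩
    exact (mem_modelIdeal_iff hn hk hJ hf).2 h
  · rintro _ ⟨j, rfl⟩
    have h := isHomogeneous_modelPoly hn k Λ j
    exact Ideal.subset_span ⟨⟨k, h⟩,
      (mem_modelIdeal_iff hn hk hJ h).1 (Ideal.subset_span ⟨j, rfl⟩)⟩

theorem isClosed_model (hn : d + 1 ≤ n) (k : ℕ) (Λ : Fin (n - d - 1) → Fin d → K) :
    IsClosed (model hn k Λ) := by
  have : model hn k Λ = ⋂ j, {P | ¬ VanishesAt (modelPoly hn k Λ j) P}ᶜ := by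
    ext P
    simp only [model, modelEquations_iff, Set.mem_iInter, Set.mem_compl_iff, Set.mem_ofPred_eq,
      not_not, VanishesAt, eval_modelPoly, sub_eq_zero]
  rw [this]
  exact isClosed_iInter fun j =>
    (isOpen_nonvanishing (isHomogeneous_modelPoly hn k Λ j)).isClosed_compl

theorem isIrreducible_model [IsAlgClosed K] (hn : d + 1 ≤ n) {k : ℕ} (hk : k ≠ 0)
    {Λ : Fin (n - d - 1) → Fin d → K} (hJ : (modelIdeal hn k Λ).IsPrime) :
    IsIrreducible (model hn k Λ) := by
  refine isIrreducible_of_mul (model_nonempty hn hk Λ) fun e e' f g hf hg h1 h2 => ?_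
  by_contra! hc
  have h3 := (mem_modelIdeal_iff hn hk hJ (hf.mul hg)).2 hc
  rcases hJ.mem_or_mem h3 with h | h
  · obtain ⟨P, hP, hP'⟩ := h1
    exact hP' ((mem_modelIdeal_iff hn hk hJ hf).1 h P hP)
  · obtain ⟨P, hP, hP'⟩ := h2
    exact hP' ((mem_modelIdeal_iff hn hk hJ hg).1 h P hP)

end ModelIdeal

/-! ## Smoothness of the model -/

section Smooth

open MvPolynomial

variable {K : Type*} [Field K] {d n : ℕ}

/-- The derivative of `f` at `v` in the direction `w`. -/
def dirDeriv {σ : Type*} [Fintype σ] (v w : σ → K) : MvPolynomial σ K →ₗ[K] K :=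
  ∑ i, w i • (aeval v : MvPolynomial σ K →ₐ[K] K).toLinearMap ∘ₗ (pderiv i).toLinearMap

theorem dirDeriv_apply {σ : Type*} [Fintype σ] (v w : σ → K) (f : MvPolynomial σ K) :
    dirDeriv v w f = ∑ i, eval v (pderiv i f) * w i := by
  simp [dirDeriv, mul_comm, aeval_eq_eval]

theorem dirDeriv_mul {σ : Type*} [Fintype σ] (v w : σ → K) (f g : MvPolynomial σ K) :
    dirDeriv v w (f * g) = eval v f * dirDeriv v w g + eval v g * dirDeriv v w f := by
  simp only [dirDeriv_apply, Finset.mul_sum, ← Finset.sum_add_distrib]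
  refine Finset.sum_congr rfl fun i _ => ?_
  simp only [Derivation.leibniz, smul_eq_mul, map_add, map_mul]
  ring

theorem dirDeriv_X_pow {σ : Type*} [Fintype σ] [DecidableEq σ] (v w : σ → K) (j : σ) (k : ℕ) :
    dirDeriv v w (X j ^ k) = k * v j ^ (k - 1) * w j := by
  rw [dirDeriv_apply, Finset.sum_eq_single j]
  · simp [Derivation.leibniz_pow]
  · intro i _ hi
    simp [Derivation.leibniz_pow, pderiv_X_of_ne hi.symm]
  · simp

theorem dirDeriv_modelPoly (hn : d + 1 ≤ n) (k : ℕ) (Λ : Fin (n - d - 1) → Fin d → K)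
    (j : Fin (n + 1)) (v w : Fin (n + 1) → K) :
    dirDeriv v w (modelPoly hn k Λ j) = k * (v j ^ (k - 1) * w j - linForm (rootCoeff Λ j)
      fun l => v (Fin.castLE (by omega) l) ^ (k - 1) * w (Fin.castLE (by omega) l)) := by
  have h : powHom K hn k (linPoly (rootCoeff Λ j)) =
      ∑ l, rootCoeff Λ j l • X (Fin.castLE (by omega) l) ^ k := by
    simp [powHom, linPoly, smul_eq_C_mul]
  rw [modelPoly, map_sub, dirDeriv_X_pow, h, map_sum, linForm_apply, mul_sub, Finset.mul_sum]
  congr 1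
  · ring
  · refine Finset.sum_congr rfl fun l _ => ?_
    rw [map_smul, dirDeriv_X_pow, smul_eq_mul]
    ring

/-- By the Leibniz rule, at a zero of the ideal it suffices to differentiate the generators; the
common factor `k` is invertible and cancels. -/
theorem mem_coneTangent_model [IsAlgClosed K] (hn : d + 1 ≤ n) {k : ℕ} [NeZero (k : K)]
    {Λ : Fin (n - d - 1) → Fin d → K} (hJ : (modelIdeal hn k Λ).IsPrime) {P : PSpace K n}
    (hP : P ∈ model hn k Λ) (w : Fin (n + 1) → K) :
    w ∈ coneTangent (model hn k Λ) P ↔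
      ∀ j, P.rep j ^ (k - 1) * w j = linForm (rootCoeff Λ j)
        fun l => P.rep (Fin.castLE (by omega) l) ^ (k - 1) * w (Fin.castLE (by omega) l) := by
  have hk : k ≠ 0 := (NeZero.of_neZero_natCast K (n := k)).ne
  have hk' : (k : K) ≠ 0 := NeZero.ne _
  have h1 : w ∈ coneTangent (model hn k Λ) P ↔ ∀ f ∈ modelIdeal hn k Λ, dirDeriv P.rep w f = 0 := by
    simp only [coneTangent, homogIdeal_model hn hk hJ, Submodule.mem_iInf, LinearMap.mem_ker,
      dirDeriv_apply]
    simp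
  rw [h1]
  constructor
  · intro h j
    have := h _ (Ideal.subset_span ⟨j, rfl⟩)
    rw [dirDeriv_modelPoly] at this
    exact sub_eq_zero.1 ((mul_eq_zero.1 this).resolve_left hk')
  · intro h f hf
    have hf0 : ∀ g ∈ modelIdeal hn k Λ, eval P.rep g = 0 := fun g hg =>
      (mem_zeroLocus_modelIdeal hn k Λ _).2 hP g hg
    induction hf using Submodule.span_induction with
    | mem x hx =>
      obtain ⟨j, rfl⟩ := hx
      rw [dirDeriv_modelPoly, h j, sub_self, mul_zero]
    | zero => rw [map_zero]
    | add x y _ _ hx hy => rw [map_add, hx, hy, add_zero]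
    | smul a x hx hx0 => rw [smul_eq_mul, dirDeriv_mul, hf0 x hx, hx0, mul_zero, zero_mul, add_zero]

/-- Only the origin is a common zero of `d + 1` forms in general position. So `d + 1` zero
coordinates would force all `k`-th powers, and then all coordinates, to vanish. The weaker bound
stated is what the rank formula requires. -/
theorem card_zeros_le (hn : d + 1 ≤ n) {k : ℕ} (hk : k ≠ 0) {Λ : Fin (n - d - 1) → Fin d → K}
    (hΛ : GeneralPosition (sigmaCoeff (n := n) Λ)) {v : Fin (n + 1) → K} (hv : v ≠ 0)
    (h : ModelEquations hn k Λ v) {Z : Finset (Fin (n + 1))} (hZ : ∀ j ∈ Z, v j = 0) :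
    Z.card ≤ d + 1 := by
  by_contra! hc
  obtain ⟨S, hSZ, hS⟩ := Finset.exists_subset_card_eq hc.le
  have h1 := (generalPosition_rootCoeff hΛ).finrank_add_card hS.le
  rw [hS, Nat.add_eq_right, Submodule.finrank_eq_zero] at h1
  rw [modelEquations_iff] at h
  have h2 : basePow hn k v ∈ (⨅ j ∈ S, LinearMap.ker (linForm (rootCoeff Λ j)) :
      Submodule K (Fin (d + 1) → K)) := by
    simp only [Submodule.mem_iInf, LinearMap.mem_ker]
    intro j hj
    rw [← h j, hZ j (hSZ hj), zero_pow hk]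
  rw [h1, Submodule.mem_bot] at h2
  apply hv
  funext j
  have := h j
  rw [h2, map_zero] at this
  exact pow_eq_zero_iff hk |>.1 this

/-- Put `u_l = v_l ^ (k - 1) * w_l` for `l ≤ d`. A tangent vector `w` satisfies `v_j ^ (k - 1) * w_j
= ℓ_j(u)`. If `v_j ≠ 0`, this determines `w_j` from `u`; if `v_j = 0`, then `w_j` is free and
`ℓ_j(u) = 0`, as `k ≥ 2`. So `w` amounts to a point `u` of `M` and free entries on `Z`. -/
theorem finrank_coneTangent_model [IsAlgClosed K] (hn : d + 1 ≤ n) {k : ℕ} (hk : 2 ≤ k)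
    [NeZero (k : K)] {Λ : Fin (n - d - 1) → Fin d → K}
    (hΛ : GeneralPosition (sigmaCoeff (n := n) Λ)) (hJ : (modelIdeal hn k Λ).IsPrime)
    {P : PSpace K n} (hP : P ∈ model hn k Λ) :
    Module.finrank K (coneTangent (model hn k Λ) P) = d + 1 := by
  classical
  set v := P.rep with hv
  have hk1 : k - 1 ≠ 0 := by omega
  set Z : Finset (Fin (n + 1)) := {j | v j = 0} with hZ
  have hZm : ∀ j, j ∈ Z ↔ v j = 0 := fun j => by simp [hZ]
  have hcard := (generalPosition_rootCoeff hΛ).finrank_add_card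
    (card_zeros_le hn (by omega) hΛ P.rep_nonzero hP fun j hj => (hZm j).1 hj)
  set M : Submodule K (Fin (d + 1) → K) := ⨅ j ∈ Z, LinearMap.ker (linForm (rootCoeff Λ j)) with hM
  have hMm : ∀ u, u ∈ M ↔ ∀ j, v j = 0 → linForm (rootCoeff Λ j) u = 0 := fun u => by
    simp [hM, Submodule.mem_iInf, hZm]
  have hT := mem_coneTangent_model hn hJ hP
  have hroot : ∀ (l : Fin (d + 1)) (u : Fin (d + 1) → K),
      linForm (rootCoeff Λ (Fin.castLE (by omega : d + 1 ≤ n + 1) l)) u = u l := fun l u => by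
    rw [rootCoeff_castLE hn, linForm_apply]
    simp [Pi.single_apply]
  let D : (Fin (n + 1) → K) →ₗ[K] (Fin (d + 1) → K) :=
    LinearMap.pi fun l => v (Fin.castLE (by omega) l) ^ (k - 1) •
      LinearMap.proj (Fin.castLE (by omega) l)
  have hD : ∀ w, D w = fun l => v (Fin.castLE (by omega) l) ^ (k - 1) *
      w (Fin.castLE (by omega) l) := fun w => rfl
  have hDM : ∀ w ∈ coneTangent (model hn k Λ) P, D w ∈ M := by
    intro w hw
    rw [hMm]
    intro j hj
    rw [hD, ← (hT w).1 hw j, ← hv, hj, zero_pow hk1, zero_mul]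
  let Ψ : coneTangent (model hn k Λ) P →ₗ[K] M × (Z → K) :=
    (D.restrict hDM).prod (LinearMap.pi fun j => (LinearMap.proj (j : Fin (n + 1))).domRestrict _)
  have hΨ : Function.Bijective Ψ := by
    constructor
    · rw [← LinearMap.ker_eq_bot, LinearMap.ker_eq_bot']
      rintro ⟨w, hw⟩ h0
      have h1 : D w = 0 := congrArg (fun x => (x.1 : Fin (d + 1) → K)) h0
      have h2 : ∀ j ∈ Z, w j = 0 := fun j hj => congrFun (congrArg Prod.snd h0) ⟨j, hj⟩
      ext j
      by_cases hj : j ∈ Z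
      · exact h2 j hj
      · have h3 := (hT w).1 hw j
        rw [← hv, ← hD, h1, map_zero] at h3
        exact (mul_eq_zero.1 h3).resolve_left (pow_ne_zero _ (mt (hZm j).2 hj))
    · rintro ⟨⟨u, hu⟩, z⟩
      rw [hMm] at hu
      set w : Fin (n + 1) → K := fun j => if hj : j ∈ Z then z ⟨j, hj⟩ else
        linForm (rootCoeff Λ j) u / v j ^ (k - 1) with hw
      have h1 : ∀ j, v j ^ (k - 1) * w j = linForm (rootCoeff Λ j) u := by
        intro j
        by_cases hj : j ∈ Z
        · have := (hZm j).1 hj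
          rw [this, zero_pow hk1, zero_mul, hu j this]
        · simp only [hw, hj, dite_false]
          exact mul_div_cancel₀ _ (pow_ne_zero _ (mt (hZm j).2 hj))
      have h2 : D w = u := by
        rw [hD]
        funext l
        rw [h1, hroot]
      refine ⟨⟨w, (hT w).2 fun j => ?_⟩, ?_⟩
      · rw [← hv, ← hD, h2, h1]
      · refine Prod.ext (Subtype.ext h2) ?_
        funext j
        change w j = z j
        simp [hw]
  rw [(LinearEquiv.ofBijective Ψ hΨ).finrank_eq, Module.finrank_prod, Module.finrank_pi,
    Fintype.card_coe, hcard]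

theorem isSmoothProjectiveVariety_model [IsAlgClosed K] (hd : 1 ≤ d) (hn : d + 1 ≤ n) {k : ℕ}
    (hk : 2 ≤ k) [NeZero (k : K)] {Λ : Fin (n - d - 1) → Fin d → K}
    (hΛ : GeneralPosition (sigmaCoeff (n := n) Λ)) {ω : K} (hω : IsPrimitiveRoot ω k) :
    IsSmoothProjectiveVariety d (model hn k Λ) := by
  have hJ := (modelIdeal_isPrime_and_injective hd hn hΛ hω).1
  have hk0 : k ≠ 0 := by omega
  refine ⟨isClosed_model hn k Λ, isIrreducible_model hn hk0 hJ, ?_,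
    fun P hP => finrank_coneTangent_model hn hk hΛ hJ hP⟩
  rw [homogIdeal_model hn hk0 hJ, ringKrullDim_quotient_modelIdeal hd hn hΛ hω]

end Smooth

/-! ## Morphisms given by homogeneous polynomials -/

section Morphisms

open MvPolynomial

variable {K : Type*} [Field K] {m m' : ℕ}

theorem eq_iff_exists_rep {P Q : PSpace K m} :
    P = Q ↔ ∃ c : K, c ≠ 0 ∧ ∀ i, Q.rep i = c * P.rep i := by
  constructor
  · rintro rfl
    exact ⟨1, one_ne_zero, fun i => (one_mul _).symm⟩
  · rintro ⟨c, hc, h⟩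
    rw [← P.mk_rep, ← Q.mk_rep]
    refine ((Projectivization.mk_eq_mk_iff' K _ _ _ _).2 ⟨c, ?_⟩).symm
    funext i
    exact (h i).symm

theorem exists_rep_mk (v : Fin (m + 1) → K) (hv : v ≠ 0) :
    ∃ c : K, c ≠ 0 ∧ ∀ i, (Projectivization.mk K v hv).rep i = c * v i := by
  obtain ⟨a, ha⟩ := Projectivization.exists_smul_eq_mk_rep K v hv
  exact ⟨a, a.ne_zero, fun i => by rw [← ha]; rfl⟩

/-- The scalar `c` accounts for the choice of representatives. On forms of degree `e` it contributes
`c ^ e`, which affects neither vanishing nor quotients of forms of equal degree. -/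
theorem isMorphism_of_isHomogeneous {X : Set (PSpace K m)} {Y : Set (PSpace K m')} (φ : X → Y)
    (g : Fin (m' + 1) → MvPolynomial (Fin (m + 1)) K) {e₀ : ℕ} (hg : ∀ i, (g i).IsHomogeneous e₀)
    (h : ∀ x, ∃ c : K, c ≠ 0 ∧ ∀ i, (φ x).1.rep i = c * eval x.1.rep (g i)) :
    IsMorphism φ := by
  choose c hc hφ using h
  have key : ∀ (x : X) (e : ℕ) (f : MvPolynomial (Fin (m' + 1)) K), f.IsHomogeneous e →
      eval (φ x).1.rep f = c x ^ e * eval x.1.rep (aeval g f) := by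
    intro x e f hf
    have h1 : (φ x).1.rep = c x • fun i => eval x.1.rep (g i) := funext fun i => hφ x i
    have h2 : eval x.1.rep (aeval g f) = eval (fun i => eval x.1.rep (g i)) f := by
      have : (eval x.1.rep).comp (aeval g : MvPolynomial (Fin (m' + 1)) K →ₐ[K] _).toRingHom =
          eval fun i => eval x.1.rep (g i) := by
        ext <;> simp
      exact RingHom.congr_fun this f
    rw [h1, h2, eval_smul_of_isHomogeneous hf]
  have key' : ∀ (x : X) (e : ℕ) (f : MvPolynomial (Fin (m' + 1)) K), f.IsHomogeneous e →
      (VanishesAt f (φ x).1 ↔ VanishesAt (aeval g f) x.1) := by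
    intro x e f hf
    rw [VanishesAt, VanishesAt, key x e f hf]
    simp [hc x]
  have hcont : Continuous φ := by
    rw [continuous_induced_rng]
    refine continuous_generateFrom_iff.2 ?_
    rintro _ ⟨e, f, hf, rfl⟩
    refine ⟨_, isOpen_nonvanishing (hf.aeval g hg), ?_⟩
    ext x
    exact not_congr (key' x e f hf).symm
  refine ⟨hcont, fun V f _ hf x hx => ?_⟩
  obtain ⟨N, hN, hxN, e, a, b, ha, hb, hab⟩ := hf (φ x) hx
  refine ⟨φ ⁻¹' N, hN.preimage hcont, hxN, e₀ * e, aeval g a, aeval g b, ha.aeval g hg,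
    hb.aeval g hg, fun y hy => ?_⟩
  obtain ⟨h1, h2⟩ := hab (φ y) hy
  refine ⟨fun h => h1 ((key' y e b hb).2 h), ?_⟩
  rw [Function.comp_apply, h2, key y e a ha, key y e b hb,
    mul_div_mul_left _ _ (pow_ne_zero _ (hc y))]

end Morphisms

/-! ## The diagonal group -/

section Diagonal

open MvPolynomial

variable {K : Type*} [Field K] {d n : ℕ}

/-- A vector space over an infinite field is not a finite union of proper subspaces. -/
theorem exists_forall_linearMap_ne_zero {V ι : Type*} [Infinite K] [AddCommGroup V] [Module K V]
    [Finite ι] (W : Submodule K V) (f : ι → V →ₗ[K] K) (h : ∀ i, ∃ y ∈ W, f i y ≠ 0) :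
    ∃ y ∈ W, ∀ i, f i y ≠ 0 := by
  by_contra! hc
  obtain ⟨i, hi⟩ := Subspace.exists_eq_top_of_iUnion_eq_univ
    (p := fun i => LinearMap.ker ((f i).domRestrict W)) (by
      refine Set.eq_univ_of_forall fun y => Set.mem_iUnion.2 ?_
      obtain ⟨i, hi⟩ := hc y y.2
      exact ⟨i, hi⟩)
  obtain ⟨y, hy, hy'⟩ := h i
  exact hy' ((LinearMap.ext_iff.1 (LinearMap.ker_eq_top.1 hi)) ⟨y, hy⟩)

/-- The diagonal linear automorphism with entries `u`. -/
def diagEquiv (u : Fin (n + 1) → Kˣ) : (Fin (n + 1) → K) ≃ₗ[K] (Fin (n + 1) → K) :=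
  LinearEquiv.piCongrRight fun i => LinearEquiv.smulOfUnit (u i)

theorem diagEquiv_apply (u : Fin (n + 1) → Kˣ) (v : Fin (n + 1) → K) (i : Fin (n + 1)) :
    diagEquiv u v i = u i * v i := rfl

theorem basePow_mul (hn : d + 1 ≤ n) {k : ℕ} {u v : Fin (n + 1) → K} (hu : ∀ i, u i ^ k = 1) :
    basePow hn k (fun i => u i * v i) = basePow hn k v := by
  funext l
  simp [basePow, mul_pow, hu]

theorem modelEquations_mul_iff (hn : d + 1 ≤ n) {k : ℕ} (Λ : Fin (n - d - 1) → Fin d → K)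
    {u v : Fin (n + 1) → K} (hu : ∀ i, u i ^ k = 1) :
    ModelEquations hn k Λ (fun i => u i * v i) ↔ ModelEquations hn k Λ v := by
  simp only [modelEquations_iff, basePow_mul hn hu, mul_pow, hu, one_mul]

theorem coe_pow_eq_one {k : ℕ} (u : rootsOfUnity k K) : ((u : Kˣ) : K) ^ k = 1 := by
  rw [← Units.val_pow_eq_pow_val, (mem_rootsOfUnity k _).1 u.2, Units.val_one]

theorem diagEquiv_smul_mem_iff (hn : d + 1 ≤ n) {k : ℕ} (Λ : Fin (n - d - 1) → Fin d → K)
    (u : Fin (n + 1) → rootsOfUnity k K) (P : PSpace K n) :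
    diagEquiv (fun i => (u i : Kˣ)) • P ∈ model hn k Λ ↔ P ∈ model hn k Λ := by
  induction P using Projectivization.ind with
  | h v hv =>
    rw [Projectivization.smul_mk, mk_mem_model_iff, mk_mem_model_iff]
    exact modelEquations_mul_iff hn Λ fun i => coe_pow_eq_one (u i)

/-- The action of the diagonal matrices of exponent `k` on the model. -/
def diagHom (hn : d + 1 ≤ n) (k : ℕ) (Λ : Fin (n - d - 1) → Fin d → K) :
    (Fin (n + 1) → rootsOfUnity k K) →* Equiv.Perm (model hn k Λ) where
  toFun u := (MulAction.toPerm (diagEquiv fun i => (u i : Kˣ)) : Equiv.Perm (PSpace K n)).subtypePerm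
    fun P => diagEquiv_smul_mem_iff hn Λ u P
  map_one' := by
    ext x : 2
    change diagEquiv (fun i => (((1 : Fin (n + 1) → rootsOfUnity k K) i : rootsOfUnity k K) : Kˣ))
      • x.1 = x.1
    have : diagEquiv (fun i => (((1 : Fin (n + 1) → rootsOfUnity k K) i : rootsOfUnity k K) : Kˣ))
      = 1 := by
      ext v i
      simp [diagEquiv_apply]
    rw [this, one_smul]
  map_mul' u w := by
    ext x : 2
    change diagEquiv (fun i => ((u * w) i : Kˣ)) • x.1 =
      diagEquiv (fun i => (u i : Kˣ)) • diagEquiv (fun i => (w i : Kˣ)) • x.1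
    rw [← mul_smul]
    congr 1
    ext v i
    simp [diagEquiv_apply, LinearEquiv.mul_apply, mul_assoc]

theorem diagHom_rep (hn : d + 1 ≤ n) {k : ℕ} {Λ : Fin (n - d - 1) → Fin d → K}
    (u : Fin (n + 1) → rootsOfUnity k K) (x : model hn k Λ) :
    ∃ c : K, c ≠ 0 ∧ ∀ i, (diagHom hn k Λ u x).1.rep i = c * (((u i : Kˣ) : K) * x.1.rep i) := by
  have h : (diagHom hn k Λ u x).1 = diagEquiv (fun i => (u i : Kˣ)) • x.1 := rfl
  conv in (diagHom _ _ _ _ _).1 => rw [h, ← x.1.mk_rep, Projectivization.smul_mk]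
  exact exists_rep_mk _ _

theorem diagHom_apply_eq_iff (hn : d + 1 ≤ n) {k : ℕ} {Λ : Fin (n - d - 1) → Fin d → K}
    (u : Fin (n + 1) → rootsOfUnity k K) (x y : model hn k Λ) :
    diagHom hn k Λ u x = y ↔
      ∃ c : K, c ≠ 0 ∧ ∀ i, y.1.rep i = c * (((u i : Kˣ) : K) * x.1.rep i) := by
  obtain ⟨c, hc, h⟩ := diagHom_rep hn u x
  rw [Subtype.ext_iff, eq_iff_exists_rep]
  constructor
  · rintro ⟨c', hc', h'⟩
    exact ⟨c' * c, mul_ne_zero hc' hc, fun i => by rw [h', h, mul_assoc]⟩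
  · rintro ⟨c', hc', h'⟩
    refine ⟨c' / c, div_ne_zero hc' hc, fun i => ?_⟩
    rw [h', h, ← mul_assoc (c' / c), div_mul_cancel₀ _ hc]

theorem phi_eq_diagHom (hn : d + 1 ≤ n) {k : ℕ} (Λ : Fin (n - d - 1) → Fin d → K) {ω : Kˣ}
    (hω : ω ^ k = 1) (j : Fin (n + 1)) :
    phi hn Λ hω j = diagHom hn k Λ (Pi.mulSingle j ⟨ω, (mem_rootsOfUnity k ω).2 hω⟩) := by
  ext x : 2
  change scaleCoord ω j • x.1 = diagEquiv (fun i => ((Pi.mulSingle j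
    ⟨ω, (mem_rootsOfUnity k ω).2 hω⟩ : Fin (n + 1) → rootsOfUnity k K) i : Kˣ)) • x.1
  congr 1
  ext v i
  rw [scaleCoord_apply, diagEquiv_apply]
  by_cases hij : i = j
  · subst hij; simp
  · simp [hij]

theorem groupH0_eq_range (hn : d + 1 ≤ n) {k : ℕ} [NeZero k] (Λ : Fin (n - d - 1) → Fin d → K)
    {ω : Kˣ} (hω : IsPrimitiveRoot ω k) :
    groupH0 hn Λ hω.pow_eq_one = (diagHom hn k Λ).range := by
  apply le_antisymm
  · rw [groupH0, Subgroup.closure_le]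
    rintro _ ⟨j, rfl⟩
    rw [phi_eq_diagHom]
    exact ⟨_, rfl⟩
  · rintro _ ⟨u, rfl⟩
    rw [← Subgroup.mem_comap, ← Finset.univ_prod_mulSingle u]
    refine Subgroup.prod_mem _ fun j _ => ?_
    obtain ⟨a, ha⟩ : ∃ a : ℤ, ω ^ a = u j := by
      have := hω.zpowers_eq.ge (u j).2
      rwa [Subgroup.mem_zpowers_iff] at this
    have h1 : (Pi.mulSingle j (u j) : Fin (n + 1) → rootsOfUnity k K) =
        Pi.mulSingle j ⟨ω, (mem_rootsOfUnity k ω).2 hω.pow_eq_one⟩ ^ a := by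
      rw [← Pi.mulSingle_zpow]
      congr 1
      ext
      simp [← ha]
    rw [h1]
    refine Subgroup.zpow_mem _ ?_ a
    rw [Subgroup.mem_comap, ← phi_eq_diagHom hn Λ hω.pow_eq_one]
    exact Subgroup.subset_closure ⟨j, rfl⟩

theorem diagHom_mem_autGroup (hn : d + 1 ≤ n) {k : ℕ} (Λ : Fin (n - d - 1) → Fin d → K)
    (u : Fin (n + 1) → rootsOfUnity k K) : diagHom hn k Λ u ∈ autGroup (model hn k Λ) := by
  have h : ∀ u, IsMorphism fun x => diagHom hn k Λ u x := fun u =>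
    isMorphism_of_isHomogeneous _ (fun i => C ((u i : Kˣ) : K) * X i)
      (fun i => isHomogeneous_C_mul_X _ _) fun x => by simpa using diagHom_rep hn u x
  refine ⟨h u, ?_⟩
  have := h u⁻¹
  rwa [map_inv] at this

theorem powerMap_rep (hn : d + 1 ≤ n) {k : ℕ} (hk : 2 ≤ k) {Λ : Fin (n - d - 1) → Fin d → K}
    (x : model hn k Λ) :
    ∃ c : K, c ≠ 0 ∧ ∀ l, (powerMap hn hk Λ x).1.rep l = c * basePow hn k x.1.rep l :=
  exists_rep_mk _ _

theorem powerMap_eq_iff (hn : d + 1 ≤ n) {k : ℕ} (hk : 2 ≤ k) {Λ : Fin (n - d - 1) → Fin d → K}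
    (x y : model hn k Λ) : powerMap hn hk Λ x = powerMap hn hk Λ y ↔
      ∃ c : K, c ≠ 0 ∧ ∀ l, basePow hn k y.1.rep l = c * basePow hn k x.1.rep l := by
  obtain ⟨c, hc, h⟩ := powerMap_rep hn hk x
  obtain ⟨c', hc', h'⟩ := powerMap_rep hn hk y
  rw [Subtype.ext_iff, eq_iff_exists_rep]
  constructor
  · rintro ⟨b, hb, hb'⟩
    refine ⟨b * c / c', div_ne_zero (mul_ne_zero hb hc) hc', fun l => ?_⟩
    have := hb' l
    rw [h, h'] at this
    field_simp
    linear_combination this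
  · rintro ⟨b, hb, hb'⟩
    refine ⟨b * c' / c, div_ne_zero (mul_ne_zero hb hc') hc, fun l => ?_⟩
    rw [h, h', hb']
    field_simp

theorem isMorphism_powerMap (hn : d + 1 ≤ n) {k : ℕ} (hk : 2 ≤ k)
    (Λ : Fin (n - d - 1) → Fin d → K) : IsMorphism (powerMap hn hk Λ) :=
  isMorphism_of_isHomogeneous _ (fun l => X (Fin.castLE (by omega) l) ^ k)
    (fun _ => isHomogeneous_X_pow _ _) fun x => by
      simpa [basePow] using powerMap_rep hn hk x

theorem powerMap_diagHom (hn : d + 1 ≤ n) {k : ℕ} (hk : 2 ≤ k) (Λ : Fin (n - d - 1) → Fin d → K)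
    (u : Fin (n + 1) → rootsOfUnity k K) (x : model hn k Λ) :
    powerMap hn hk Λ (diagHom hn k Λ u x) = powerMap hn hk Λ x := by
  obtain ⟨c, hc, h⟩ := diagHom_rep hn u x
  rw [eq_comm, powerMap_eq_iff]
  refine ⟨c ^ k, pow_ne_zero _ hc, fun l => ?_⟩
  simp [basePow, h, mul_pow, coe_pow_eq_one]

theorem rep_pow_eq (hn : d + 1 ≤ n) {k : ℕ} {Λ : Fin (n - d - 1) → Fin d → K}
    (x : model hn k Λ) (j : Fin (n + 1)) :
    x.1.rep j ^ k = linForm (rootCoeff Λ j) (basePow hn k x.1.rep) :=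
  (modelEquations_iff hn k Λ _).1 x.2 j

/-- After rescaling `x` by a `k`-th root of the proportionality factor, the `k`-th powers of all `n
+ 1` coordinates agree, since the later ones are linear in the first `d + 1`. Corresponding
coordinates then differ by roots of unity, arbitrary where they vanish. -/
theorem exists_diagHom_eq [IsAlgClosed K] (hn : d + 1 ≤ n) {k : ℕ} (hk : 2 ≤ k)
    {Λ : Fin (n - d - 1) → Fin d → K} {x y : model hn k Λ}
    (h : powerMap hn hk Λ x = powerMap hn hk Λ y) : ∃ u, diagHom hn k Λ u x = y := by
  have hk0 : k ≠ 0 := by omega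
  obtain ⟨c, hc, h⟩ := (powerMap_eq_iff hn hk x y).1 h
  obtain ⟨s, hs⟩ := IsAlgClosed.exists_pow_nat_eq c (Nat.pos_of_ne_zero hk0)
  have hs0 : s ≠ 0 := by
    rintro rfl
    exact hc (by rw [← hs, zero_pow hk0])
  have hj : ∀ j, y.1.rep j ^ k = (s * x.1.rep j) ^ k := fun j => by
    rw [mul_pow, rep_pow_eq, rep_pow_eq, hs, show basePow hn k y.1.rep = c • basePow hn k x.1.rep
      from funext h, map_smul, smul_eq_mul]
  have hu : ∀ j, ∃ u : rootsOfUnity k K, y.1.rep j = s * (((u : Kˣ) : K) * x.1.rep j) := by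
    intro j
    by_cases hx : x.1.rep j = 0
    · refine ⟨1, ?_⟩
      have := hj j
      rw [hx, mul_zero, zero_pow hk0] at this
      rw [hx, mul_zero, mul_zero]
      exact (pow_eq_zero_iff hk0).1 this
    · have hx' : s * x.1.rep j ≠ 0 := mul_ne_zero hs0 hx
      have hone : (y.1.rep j / (s * x.1.rep j)) ^ k = 1 := by
        rw [div_pow, hj, div_self (pow_ne_zero _ hx')]
      refine ⟨⟨Units.ofPowEqOne _ k hone hk0, Units.pow_ofPowEqOne hone hk0⟩, ?_⟩
      rw [Units.val_ofPowEqOne]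
      field_simp
  choose u hu using hu
  exact ⟨u, (diagHom_apply_eq_iff hn u x y).2 ⟨s, hs0, hu⟩⟩

theorem surjective_powerMap [IsAlgClosed K] (hn : d + 1 ≤ n) {k : ℕ} (hk : 2 ≤ k)
    (Λ : Fin (n - d - 1) → Fin d → K) : Function.Surjective (powerMap hn hk Λ) := by
  rintro ⟨Q, hQ⟩
  obtain ⟨v, hv, h, hb⟩ := exists_modelEquations hn (by omega : k ≠ 0) Λ Q.rep_nonzero
  refine ⟨⟨_, (mk_mem_model_iff hn k Λ v hv).2 h⟩, Subtype.ext ?_⟩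
  rw [powerMap_mk hn hk Λ v hv h, ← Q.mk_rep]
  congr 1

theorem powerMap_mem_hyperplane_iff (hn : d + 1 ≤ n) {k : ℕ} (hk : 2 ≤ k)
    {Λ : Fin (n - d - 1) → Fin d → K} (x : model hn k Λ) (j : Fin (n + 1)) :
    powerMap hn hk Λ x ∈ hyperplane (sigmaCoeff Λ j) ↔ x.1.rep j = 0 := by
  obtain ⟨c, hc, h⟩ := powerMap_rep hn hk x
  have h1 : powerMap hn hk Λ x ∈ hyperplane (sigmaCoeff Λ j) ↔
      linForm (sigmaCoeff Λ j) (powerMap hn hk Λ x).1.rep = 0 := by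
    rw [linForm_apply]; rfl
  rw [h1, show (powerMap hn hk Λ x).1.rep = c • basePow hn k x.1.rep from funext h, map_smul,
    smul_eq_zero_iff_right hc, ← linForm_rootCoeff_eq_zero_iff, ← rep_pow_eq,
    pow_eq_zero_iff (by omega)]

theorem exists_generic_vector [Infinite K] {Λ : Fin (n - d - 1) → Fin d → K}
    (hΛ : GeneralPosition (sigmaCoeff (n := n) Λ)) :
    ∃ y : Fin (d + 1) → K, y ≠ 0 ∧ ∀ i : Fin (n + 1), linForm (sigmaCoeff Λ i) y ≠ 0 := by
  obtain ⟨y, -, hy⟩ := exists_forall_linearMap_ne_zero ⊤ (fun i => linForm (sigmaCoeff (n := n) Λ i))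
    fun i => by
      obtain ⟨y, hy⟩ := hΛ.exists_linForm_ne_zero i
      exact ⟨y, trivial, hy⟩
  exact ⟨y, fun h => hy 0 (by rw [h, map_zero]), hy⟩

theorem exists_generic_vector_of_hyperplane [Infinite K] (hd : 1 ≤ d) (hn : d + 1 ≤ n)
    {Λ : Fin (n - d - 1) → Fin d → K} (hΛ : GeneralPosition (sigmaCoeff (n := n) Λ))
    (j : Fin (n + 1)) : ∃ y : Fin (d + 1) → K, y ≠ 0 ∧ linForm (sigmaCoeff Λ j) y = 0 ∧
      ∀ i ≠ j, linForm (sigmaCoeff Λ i) y ≠ 0 := by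
  obtain ⟨y, hyj, hy⟩ := exists_forall_linearMap_ne_zero (LinearMap.ker (linForm (sigmaCoeff Λ j)))
    (fun i : {i : Fin (n + 1) // i ≠ j} => linForm (sigmaCoeff Λ i.1))
    fun i => hΛ.exists_linForm_eq_zero_ne_zero hd i.2.symm
  have : Nontrivial (Fin (n + 1)) := Fin.nontrivial_iff_two_le.2 (by omega)
  obtain ⟨i, hi⟩ := exists_ne j
  exact ⟨y, fun h => hy ⟨i, hi⟩ (by rw [h, map_zero]), hyj, fun i hi => hy ⟨i, hi⟩⟩

theorem exists_powerMap_eq [IsAlgClosed K] (hn : d + 1 ≤ n) {k : ℕ} (hk : 2 ≤ k)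
    (Λ : Fin (n - d - 1) → Fin d → K) {y : Fin (d + 1) → K} (hy : y ≠ 0) :
    ∃ x : model hn k Λ, (powerMap hn hk Λ x).1 = Projectivization.mk K y hy ∧
      ∀ j, x.1.rep j = 0 ↔ linForm (sigmaCoeff Λ j) y = 0 := by
  obtain ⟨x, hx⟩ := surjective_powerMap hn hk Λ ⟨Projectivization.mk K y hy, trivial⟩
  refine ⟨x, by rw [hx], fun j => ?_⟩
  obtain ⟨c, hc, h⟩ := exists_rep_mk y hy
  rw [← powerMap_mem_hyperplane_iff hn hk, hx]
  have h1 : ((⟨Projectivization.mk K y hy, trivial⟩ : fullSpace K d) ∈ hyperplane (sigmaCoeff Λ j)) ↔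
      linForm (sigmaCoeff Λ j) (Projectivization.mk K y hy).rep = 0 := by
    rw [linForm_apply]; rfl
  rw [h1, show (Projectivization.mk K y hy).rep = c • y from funext h, map_smul,
    smul_eq_zero_iff_right hc]

theorem exists_rep_ne_zero [IsAlgClosed K] (hn : d + 1 ≤ n) {k : ℕ} (hk : 2 ≤ k)
    {Λ : Fin (n - d - 1) → Fin d → K} (hΛ : GeneralPosition (sigmaCoeff (n := n) Λ)) :
    ∃ x : model hn k Λ, ∀ j, x.1.rep j ≠ 0 := by
  have := IsAlgClosed.instInfinite (K := K)
  obtain ⟨y, hy, h⟩ := exists_generic_vector hΛ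
  obtain ⟨x, -, hx⟩ := exists_powerMap_eq hn hk Λ hy
  exact ⟨x, fun j => mt (hx j).1 (h j)⟩

/-- A fixed projective point is an eigenvector, so the diagonal entries at its non-zero coordinates
all equal one eigenvalue. -/
theorem eq_of_diagHom_apply_eq (hn : d + 1 ≤ n) {k : ℕ} {Λ : Fin (n - d - 1) → Fin d → K}
    {u : Fin (n + 1) → rootsOfUnity k K} {x : model hn k Λ} (h : diagHom hn k Λ u x = x)
    {i j : Fin (n + 1)} (hi : x.1.rep i ≠ 0) (hj : x.1.rep j ≠ 0) : u i = u j := by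
  obtain ⟨c, hc, h⟩ := (diagHom_apply_eq_iff hn u x x).1 h
  have key : ∀ i, x.1.rep i ≠ 0 → c * ((u i : Kˣ) : K) = 1 := fun i hi =>
    mul_right_cancel₀ hi (by rw [one_mul, mul_assoc, ← h i])
  ext
  exact mul_left_cancel₀ hc ((key i hi).trans (key j hj).symm)

theorem diagHom_const (hn : d + 1 ≤ n) {k : ℕ} (Λ : Fin (n - d - 1) → Fin d → K)
    (c : rootsOfUnity k K) : diagHom hn k Λ (fun _ => c) = 1 := by
  ext x : 1
  exact (diagHom_apply_eq_iff hn _ x x).2 ⟨((c : Kˣ) : K)⁻¹, by simp, fun i => by simp⟩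

theorem diagHom_eq_one_of_apply_eq (hn : d + 1 ≤ n) {k : ℕ} {Λ : Fin (n - d - 1) → Fin d → K}
    {u : Fin (n + 1) → rootsOfUnity k K} {x : model hn k Λ} (hx : ∀ j, x.1.rep j ≠ 0)
    (h : diagHom hn k Λ u x = x) : diagHom hn k Λ u = 1 := by
  have : u = fun _ => u 0 := funext fun i => eq_of_diagHom_apply_eq hn h (hx i) (hx 0)
  rw [this, diagHom_const]

/-- The diagonal matrices with first entry `1`. -/
def diagConsHom (hn : d + 1 ≤ n) (k : ℕ) (Λ : Fin (n - d - 1) → Fin d → K) :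
    (Fin n → rootsOfUnity k K) →* Equiv.Perm (model hn k Λ) :=
  (diagHom hn k Λ).comp
    { toFun := fun u => Fin.cons 1 u
      map_one' := by
        funext i
        refine Fin.cases ?_ (fun i => ?_) i <;> simp
      map_mul' := fun u w => by
        funext i
        refine Fin.cases ?_ (fun i => ?_) i <;> simp }

theorem diagConsHom_apply (hn : d + 1 ≤ n) (k : ℕ) (Λ : Fin (n - d - 1) → Fin d → K)
    (u : Fin n → rootsOfUnity k K) : diagConsHom hn k Λ u = diagHom hn k Λ (Fin.cons 1 u) := rfl

/-- Scalar matrices act trivially, so the first entry can be normalized to `1`; this is why the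
group has rank `n` and not `n + 1`. -/
theorem range_diagConsHom (hn : d + 1 ≤ n) (k : ℕ) (Λ : Fin (n - d - 1) → Fin d → K) :
    (diagConsHom hn k Λ).range = (diagHom hn k Λ).range := by
  apply le_antisymm
  · rintro _ ⟨u, rfl⟩
    exact ⟨_, rfl⟩
  · rintro _ ⟨u, rfl⟩
    refine ⟨fun i => (u 0)⁻¹ * u i.succ, ?_⟩
    have : u = (fun _ => u 0) * Fin.cons 1 (fun i : Fin n => (u 0)⁻¹ * u i.succ) := by
      funext i
      refine Fin.cases ?_ (fun i => ?_) i <;> simp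
    rw [diagConsHom_apply]
    conv_rhs => rw [this, map_mul, diagHom_const, one_mul]

theorem injective_diagConsHom [IsAlgClosed K] (hn : d + 1 ≤ n) {k : ℕ} (hk : 2 ≤ k)
    {Λ : Fin (n - d - 1) → Fin d → K} (hΛ : GeneralPosition (sigmaCoeff (n := n) Λ)) :
    Function.Injective (diagConsHom hn k Λ) := by
  rw [injective_iff_map_eq_one]
  intro u hu
  obtain ⟨x, hx⟩ := exists_rep_ne_zero hn hk hΛ
  rw [diagConsHom_apply] at hu
  funext i
  have := eq_of_diagHom_apply_eq hn (x := x) (by rw [hu]; rfl) (hx i.succ) (hx 0)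
  simpa using this

theorem nonempty_groupH0_equiv [IsAlgClosed K] (hn : d + 1 ≤ n) {k : ℕ} (hk : 2 ≤ k)
    {Λ : Fin (n - d - 1) → Fin d → K} (hΛ : GeneralPosition (sigmaCoeff (n := n) Λ)) {ω : Kˣ}
    (hω : IsPrimitiveRoot ω k) :
    Nonempty (groupH0 hn Λ hω.pow_eq_one ≃* Multiplicative (Fin n → ZMod k)) := by
  have : NeZero k := ⟨by omega⟩
  have e1 := (MonoidHom.ofInjective (injective_diagConsHom hn hk hΛ)).symm
  rw [range_diagConsHom, ← groupH0_eq_range hn Λ hω] at e1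
  have e2 : rootsOfUnity k K ≃* Multiplicative (ZMod k) :=
    mulEquivOfCyclicCardEq (by
      rw [hω.card_rootsOfUnity']
      simp)
  exact ⟨e1.trans ((MulEquiv.piCongrRight fun _ => e2).trans
    (MulEquiv.funMultiplicative (Fin n) (ZMod k)).symm)⟩

end Diagonal

/-! ## Averaging over the diagonal group -/

section Average

open MvPolynomial

variable {K : Type*} [Field K] {d n : ℕ}

theorem geom_sum_fin_of_pow_eq_one [DecidableEq K] {k : ℕ} {z : K} (hz : z ^ k = 1) :
    ∑ i : Fin k, z ^ (i : ℕ) = if z = 1 then (k : K) else 0 := by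
  rw [Fin.sum_univ_eq_sum_range (fun i => z ^ i)]
  split_ifs with h
  · simp [h]
  · have := geom_sum_mul z k
    rw [hz, sub_self] at this
    exact (mul_eq_zero.1 this).resolve_right (sub_ne_zero.2 h)

/-- Twist of a vector by powers of `ω`. -/
def twist {k : ℕ} (ω : K) (a : Fin (n + 1) → Fin k) (v : Fin (n + 1) → K) : Fin (n + 1) → K :=
  fun j => ω ^ (a j : ℕ) * v j

theorem pow_pow_eq_one {k : ℕ} {ω : K} (hω : IsPrimitiveRoot ω k) (i : ℕ) : (ω ^ i) ^ k = 1 := by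
  rw [← pow_mul, mul_comm, pow_mul, hω.pow_eq_one, one_pow]

theorem twist_ne_zero {k : ℕ} [NeZero k] {ω : K} (hω : IsPrimitiveRoot ω k)
    (a : Fin (n + 1) → Fin k) {v : Fin (n + 1) → K} (hv : v ≠ 0) : twist ω a v ≠ 0 := by
  obtain ⟨j, hj⟩ := Function.ne_iff.1 hv
  exact Function.ne_iff.2 ⟨j, mul_ne_zero (pow_ne_zero _ (hω.ne_zero (NeZero.ne k))) hj⟩

theorem basePow_twist (hn : d + 1 ≤ n) {k : ℕ} {ω : K} (hω : IsPrimitiveRoot ω k)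
    (a : Fin (n + 1) → Fin k) (v : Fin (n + 1) → K) :
    basePow hn k (twist ω a v) = basePow hn k v :=
  basePow_mul hn fun i => pow_pow_eq_one hω (a i)

theorem modelEquations_twist (hn : d + 1 ≤ n) {k : ℕ} {Λ : Fin (n - d - 1) → Fin d → K} {ω : K}
    (hω : IsPrimitiveRoot ω k) (a : Fin (n + 1) → Fin k) {v : Fin (n + 1) → K}
    (h : ModelEquations hn k Λ v) : ModelEquations hn k Λ (twist ω a v) :=
  (modelEquations_mul_iff hn Λ fun i => pow_pow_eq_one hω (a i)).2 h

/-- The average of a polynomial over the diagonal group descends to a polynomial in the `k`-th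
powers of the first coordinates. -/
theorem exists_average (hn : d + 1 ≤ n) {k : ℕ} (Λ : Fin (n - d - 1) → Fin d → K) {ω : K}
    (hω : IsPrimitiveRoot ω k) (f : MvPolynomial (Fin (n + 1)) K) :
    ∃ F : MvPolynomial (Fin (d + 1)) K, ∀ v, ModelEquations hn k Λ v →
      ∑ a : Fin (n + 1) → Fin k, eval (twist ω a v) f = eval (basePow hn k v) F := by
  classical
  induction f using MvPolynomial.induction_on' with
  | monomial m u =>
    -- The sum over the group factors into one character sum per coordinate. It vanishes unless `k ∣
    -- m j`, in which case it is `k * (v j ^ k) ^ (m j / k)`.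
    refine ⟨C u * ∏ j, if k ∣ m j then C (k : K) * linPoly (rootCoeff Λ j) ^ (m j / k) else 0,
      fun v hv => ?_⟩
    rw [modelEquations_iff] at hv
    have h1 : ∀ j, ∑ b : Fin k, (ω ^ (b : ℕ) * v j) ^ m j = eval (basePow hn k v)
        (if k ∣ m j then C (k : K) * linPoly (rootCoeff Λ j) ^ (m j / k) else 0) := by
      intro j
      have h2 : ∀ b : Fin k, (ω ^ (b : ℕ) * v j) ^ m j = (ω ^ m j) ^ (b : ℕ) * v j ^ m j :=
        fun b => by rw [mul_pow, ← pow_mul, ← pow_mul, mul_comm (m j)]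
      simp_rw [h2]
      rw [← Finset.sum_mul, geom_sum_fin_of_pow_eq_one (pow_pow_eq_one hω _)]
      simp only [hω.pow_eq_one_iff_dvd]
      split_ifs with h
      · rw [map_mul, eval_C, map_pow, eval_linPoly, ← hv, ← pow_mul, Nat.mul_div_cancel' h]
      · simp
    rw [map_mul, eval_C, map_prod]
    simp_rw [← h1, Finset.prod_univ_sum, Fintype.piFinset_univ, Finset.mul_sum]
    refine Finset.sum_congr rfl fun a _ => ?_
    rw [eval_monomial, Finsupp.prod_fintype _ _ (fun _ => pow_zero _)]
    rfl
  | add p q hp hq =>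
    obtain ⟨F, hF⟩ := hp
    obtain ⟨G, hG⟩ := hq
    exact ⟨F + G, fun v hv => by simp [Finset.sum_add_distrib, hF v hv, hG v hv]⟩

/-- A polynomial that does not vanish at `v` has a multiple with non-zero average at `v`. -/
theorem exists_sum_twist_mul_ne_zero {k : ℕ} [NeZero (k : K)] {ω : K} (hω : IsPrimitiveRoot ω k)
    {v : Fin (n + 1) → K} {b : MvPolynomial (Fin (n + 1)) K} (hb : eval v b ≠ 0) :
    ∃ c : MvPolynomial (Fin (n + 1)) K,
      ∑ a : Fin (n + 1) → Fin k, eval (twist ω a v) (b * c) ≠ 0 := by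
  classical
  have hk : NeZero k := NeZero.of_neZero_natCast K
  -- The multiplier is a product of geometric sums in `X j / v j`, and `χ` records its factors at
  -- the twists of `v`. It vanishes at every twist other than `v` itself. Coordinates with `v j = 0`
  -- are unaffected by twisting and get the factor `1`. The total is `k ^ (n + 1) * eval v b`.
  set χ : Fin (n + 1) → Fin k → K := fun j i => if v j = 0 then 1 else
    if ω ^ (i : ℕ) = 1 then (k : K) else 0 with hχ
  have hc : ∀ a : Fin (n + 1) → Fin k, eval (twist ω a v) (∏ j, if v j = 0 then 1 else
      ∑ i : Fin k, (C (v j)⁻¹ * X j) ^ (i : ℕ)) = ∏ j, χ j (a j) := by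
    intro a
    rw [map_prod]
    refine Finset.prod_congr rfl fun j _ => ?_
    simp only [hχ]
    by_cases h1 : v j = 0
    · simp [h1]
    · rw [if_neg h1, if_neg h1, map_sum, ← geom_sum_fin_of_pow_eq_one (pow_pow_eq_one hω _)]
      refine Finset.sum_congr rfl fun i _ => ?_
      rw [map_pow, map_mul, eval_C, eval_X, twist, mul_left_comm, inv_mul_cancel₀ h1, mul_one]
  refine ⟨∏ j, if v j = 0 then 1 else ∑ i : Fin k, (C (v j)⁻¹ * X j) ^ (i : ℕ), ?_⟩
  simp_rw [map_mul, hc]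
  have h1 : ∀ a : Fin (n + 1) → Fin k, eval (twist ω a v) b * ∏ j, χ j (a j) =
      eval v b * ∏ j, χ j (a j) := by
    intro a
    by_cases h0 : ∏ j, χ j (a j) = 0
    · rw [h0, mul_zero, mul_zero]
    · have : twist ω a v = v := by
        funext j
        have h2 := Finset.prod_ne_zero_iff.1 h0 j (Finset.mem_univ j)
        by_cases hv : v j = 0
        · simp [twist, hv]
        · have h3 : ω ^ (a j : ℕ) = 1 := by
            by_contra h3
            exact h2 (by simp [hχ, hv, h3])
          rw [twist, h3, one_mul]
      rw [this]
  have h2 : ∀ j, ∑ i, χ j i = k := by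
    intro j
    simp only [hχ]
    by_cases hv : v j = 0
    · simp [hv]
    · simp only [hv, if_false]
      rw [Finset.sum_eq_single (0 : Fin k)]
      · simp
      · intro i _ hi
        rw [if_neg]
        intro h
        exact hi (Fin.ext (by
          simpa using Nat.eq_zero_of_dvd_of_lt ((hω.pow_eq_one_iff_dvd _).1 h) i.2))
      · simp
  simp_rw [h1]
  rw [← Finset.mul_sum, ← Fintype.piFinset_univ, ← Finset.prod_univ_sum]
  simp_rw [h2]
  exact mul_ne_zero hb (Finset.prod_ne_zero_iff.2 fun _ _ => NeZero.ne _)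

end Average

/-! ## The Galois cover -/

section Cover

open MvPolynomial

variable {K : Type*} [Field K] {m m' : ℕ}

theorem isOpen_nonvanishing_subtype (X : Set (PSpace K m)) {e : ℕ}
    {f : MvPolynomial (Fin (m + 1)) K} (hf : f.IsHomogeneous e) :
    IsOpen {x : X | ¬ VanishesAt f x.1} :=
  (isOpen_nonvanishing hf).preimage continuous_subtype_val

/-- The locus where two morphisms agree is closed. We only need morphisms whose values have the
same coordinate hyperplanes through them. -/
theorem isClosed_setOf_eq_of_isMorphism {W : Set (PSpace K m)} {Y : Set (PSpace K m')}
    {φ ψ : W → Y} (hφ : IsMorphism φ) (hψ : IsMorphism ψ)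
    (hz : ∀ x i, (φ x).1.rep i = 0 ↔ (ψ x).1.rep i = 0) : IsClosed {x | φ x = ψ x} := by
  rw [← isOpen_compl_iff, isOpen_iff_forall_mem_open]
  intro x hx
  obtain ⟨i, hi⟩ := Function.ne_iff.1 (φ x).1.rep_nonzero
  have hi' : (ψ x).1.rep i ≠ 0 := mt (hz x i).2 hi
  -- Two different points with non-zero `i`-th coordinate are separated by some regular function
  -- `x_j / x_i`.
  obtain ⟨j, hj⟩ : ∃ j, (φ x).1.rep j / (φ x).1.rep i ≠ (ψ x).1.rep j / (ψ x).1.rep i := by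
    by_contra! hc
    refine hx (Subtype.ext (eq_iff_exists_rep.2
      ⟨(ψ x).1.rep i / (φ x).1.rep i, div_ne_zero hi' hi, fun j => ?_⟩))
    rw [div_mul_eq_mul_div, mul_div_assoc, hc j, mul_div_cancel₀ _ hi']
  set V : Set Y := {y | ¬ VanishesAt (X i) y.1} with hV
  have hVo : IsOpen V := isOpen_nonvanishing_subtype Y (isHomogeneous_X K i)
  have hmV : ∀ y : Y, y ∈ V ↔ y.1.rep i ≠ 0 := fun y => by simp [hV, VanishesAt]
  have hreg : RegularOn V fun y : Y => y.1.rep j / y.1.rep i := fun y hy =>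
    ⟨V, hVo, hy, 1, X j, X i, isHomogeneous_X K j, isHomogeneous_X K i, fun z hz =>
      ⟨hz.1, by simp⟩⟩
  obtain ⟨N, hN, hxN, e, a, b, ha, hb, hab⟩ := hφ.regular V _ hVo hreg x ((hmV _).2 hi)
  obtain ⟨N', hN', hxN', e', a', b', ha', hb', hab'⟩ := hψ.regular V _ hVo hreg x ((hmV _).2 hi')
  -- The two pullbacks of this function are `a / b` and `a' / b'` near `x`; they differ wherever `a
  -- * b' - a' * b` is non-zero.
  refine ⟨N ∩ N' ∩ φ ⁻¹' V ∩ ψ ⁻¹' V ∩ {y | ¬ VanishesAt (a * b' - a' * b) y.1}, ?_,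
    (((hN.inter hN').inter (hVo.preimage hφ.continuous)).inter (hVo.preimage hψ.continuous)).inter
      (isOpen_nonvanishing_subtype W ((ha.mul hb').sub (add_comm e' e ▸ ha'.mul hb))), ?_⟩
  · rintro y ⟨⟨⟨⟨hyN, hyN'⟩, hyφ⟩, hyψ⟩, hy⟩ heq
    obtain ⟨h1, h2⟩ := hab y ⟨hyN, hyφ⟩
    obtain ⟨h1', h2'⟩ := hab' y ⟨hyN', hyψ⟩
    apply hy
    rw [Function.comp_apply, show φ y = ψ y from heq] at h2
    rw [Function.comp_apply, h2, div_eq_div_iff h1 h1'] at h2'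
    rw [VanishesAt, map_sub, map_mul, map_mul, h2', sub_self]
  · refine ⟨⟨⟨⟨hxN, hxN'⟩, (hmV _).2 hi⟩, (hmV _).2 hi'⟩, fun h0 => hj ?_⟩
    obtain ⟨h1, h2⟩ := hab x ⟨hxN, (hmV _).2 hi⟩
    obtain ⟨h1', h2'⟩ := hab' x ⟨hxN', (hmV _).2 hi'⟩
    rw [VanishesAt, map_sub, map_mul, map_mul, sub_eq_zero] at h0
    rw [Function.comp_apply] at h2 h2'
    rw [h2, h2', div_eq_div_iff h1 h1', h0]

theorem exists_subset_of_isIrreducible {α ι : Type*} [TopologicalSpace α] [Finite ι] {s : Set α}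
    (hs : IsIrreducible s) {C : ι → Set α} (hC : ∀ i, IsClosed (C i)) (h : s ⊆ ⋃ i, C i) :
    ∃ i, s ⊆ C i := by
  classical
  have := Fintype.ofFinite ι
  obtain ⟨z, hz, hsz⟩ := isIrreducible_iff_sUnion_isClosed.1 hs (Finset.univ.image C)
    (by simpa using hC) (by simpa using h)
  obtain ⟨i, -, rfl⟩ := Finset.mem_image.1 hz
  exact ⟨i, hsz⟩

variable {d n : ℕ}

/-- The point of the model with coordinate vector `v`. -/
def modelPoint (hn : d + 1 ≤ n) {k : ℕ} {Λ : Fin (n - d - 1) → Fin d → K} {v : Fin (n + 1) → K}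
    (hv : v ≠ 0) (h : ModelEquations hn k Λ v) : model hn k Λ :=
  ⟨Projectivization.mk K v hv, (mk_mem_model_iff hn k Λ v hv).2 h⟩

theorem powerMap_modelPoint (hn : d + 1 ≤ n) {k : ℕ} (hk : 2 ≤ k)
    {Λ : Fin (n - d - 1) → Fin d → K} {v : Fin (n + 1) → K} (hv : v ≠ 0)
    (h : ModelEquations hn k Λ v) {y : Fin (d + 1) → K} (hy : y ≠ 0) (hvy : basePow hn k v = y) :
    powerMap hn hk Λ (modelPoint hn hv h) = ⟨Projectivization.mk K y hy, trivial⟩ := by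
  subst hvy
  exact Subtype.ext (powerMap_mk hn hk Λ v hv h)

/-- Take `f` non-zero at a lift of `Q ∈ V` and zero off the preimage of `V`. A suitable multiple has
average `F` non-zero at `Q`. Over a point outside `V` all twists of a lift lie outside the preimage,
so `F` vanishes there. As `F` need not be homogeneous, `isClosed_of_separated` is used. -/
theorem isOpen_of_isOpen_preimage_powerMap [IsAlgClosed K] (hn : d + 1 ≤ n) {k : ℕ} (hk : 2 ≤ k)
    [NeZero (k : K)] {Λ : Fin (n - d - 1) → Fin d → K} {ω : K} (hω : IsPrimitiveRoot ω k)
    {V : Set (fullSpace K d)} (hV : IsOpen (powerMap hn hk Λ ⁻¹' V)) : IsOpen V := by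
  have hk0 : k ≠ 0 := by omega
  have : NeZero k := ⟨hk0⟩
  have := IsAlgClosed.instInfinite (K := K)
  suffices h : IsClosed {Q : PSpace K d | (⟨Q, trivial⟩ : fullSpace K d) ∉ V} by
    convert h.isOpen_compl.preimage (continuous_subtype_val (p := (· ∈ fullSpace K d))) using 1
    ext Q
    simp
  refine isClosed_of_separated fun Q hQ => ?_
  have hQ' : (⟨Q, trivial⟩ : fullSpace K d) ∈ V := not_not.1 hQ
  obtain ⟨v, hv, hvm, hb⟩ := exists_modelEquations hn hk0 Λ Q.rep_nonzero
  obtain ⟨O, hO, hOV⟩ := isOpen_induced_iff.1 hV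
  have hmem : ∀ (w : Fin (n + 1) → K) (hw : w ≠ 0) (hwm : ModelEquations hn k Λ w)
      (y : Fin (d + 1) → K) (hy : y ≠ 0), basePow hn k w = y →
      (Projectivization.mk K w hw ∈ O ↔
        (⟨Projectivization.mk K y hy, trivial⟩ : fullSpace K d) ∈ V) := by
    intro w hw hwm y hy hwy
    rw [← powerMap_modelPoint hn hk hw hwm hy hwy]
    exact Set.ext_iff.1 hOV (modelPoint hn hw hwm)
  obtain ⟨e, f, hf, hfv, hfO⟩ := exists_nonvanishing_subset hO
    ((hmem v hv hvm _ Q.rep_nonzero hb).2 (by simpa only [Q.mk_rep] using hQ'))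
  rw [vanishesAt_mk hf] at hfv
  obtain ⟨c, hc⟩ := exists_sum_twist_mul_ne_zero hω hfv
  obtain ⟨F, hF⟩ := exists_average hn Λ hω (f * c)
  refine ⟨F, by rwa [← hb, ← hF v hvm], fun y hy hyV => ?_⟩
  obtain ⟨w, hw, hwm, hwy⟩ := exists_modelEquations hn hk0 Λ hy
  rw [← hwy, ← hF w hwm]
  refine Finset.sum_eq_zero fun a _ => ?_
  have h1 := mt (hmem (twist ω a w) (twist_ne_zero hω a hw) (modelEquations_twist hn hω a hwm) y hy
    (by rw [basePow_twist hn hω, hwy])).1 hyV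
  have h2 := not_not.1 (mt (hfO _) h1)
  rw [vanishesAt_mk hf] at h2
  rw [map_mul, h2, zero_mul]

/-- Near a lift of `Q` the pullback is `a / b` on `{g ≠ 0}`. Multiplying by `g` gives an identity on
the whole cone, and averaging it after multiplication by `c` gives `B * f = A` below, because `f ∘
π_0` is constant on orbits. A homogeneous component of `B` that is non-zero at `Q` serves as
denominator. -/
theorem regularOn_of_regularOn_comp_powerMap [IsAlgClosed K] (hn : d + 1 ≤ n) {k : ℕ}
    (hk : 2 ≤ k) [NeZero (k : K)] {Λ : Fin (n - d - 1) → Fin d → K} {ω : K}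
    (hω : IsPrimitiveRoot ω k) {V : Set (fullSpace K d)} {f : fullSpace K d → K} (hV : IsOpen V)
    (h : RegularOn (powerMap hn hk Λ ⁻¹' V) (f ∘ powerMap hn hk Λ)) : RegularOn V f := by
  have hk0 : k ≠ 0 := by omega
  have : NeZero k := ⟨hk0⟩
  have := IsAlgClosed.instInfinite (K := K)
  intro Q hQ
  obtain ⟨v, hv, hvm, hb⟩ := exists_modelEquations hn hk0 Λ Q.1.rep_nonzero
  have hvQ : powerMap hn hk Λ (modelPoint hn hv hvm) = Q := by
    rw [powerMap_modelPoint hn hk hv hvm Q.1.rep_nonzero hb]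
    exact Subtype.ext Q.1.mk_rep
  have hvV : modelPoint hn hv hvm ∈ powerMap hn hk Λ ⁻¹' V := by
    rwa [Set.mem_preimage, hvQ]
  obtain ⟨N, hN, hvN, e, a, b, ha, hbh, hab⟩ := h _ hvV
  obtain ⟨O, hO, hON⟩ := isOpen_induced_iff.1
    (hN.inter (hV.preimage (isMorphism_powerMap hn hk Λ).continuous))
  obtain ⟨eg, g, hg, hgv, hgO⟩ := exists_nonvanishing_subset hO
    (show (modelPoint hn hv hvm).1 ∈ O from (Set.ext_iff.1 hON _).2 ⟨hvN, hvV⟩)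
  have hgN : ∀ x : model hn k Λ, ¬ VanishesAt g x.1 → x ∈ N ∩ powerMap hn hk Λ ⁻¹' V :=
    fun x hx => (Set.ext_iff.1 hON x).1 (hgO _ hx)
  -- the quotient represents the function on the whole preimage after clearing denominators
  have hrep : ∀ (w : Fin (n + 1) → K) (hw : w ≠ 0) (hwm : ModelEquations hn k Λ w)
      (y : Fin (d + 1) → K) (hy : y ≠ 0), basePow hn k w = y →
      eval w (g * b) * f ⟨Projectivization.mk K y hy, trivial⟩ = eval w (g * a) := by
    intro w hw hwm y hy hwy
    by_cases hgw : eval w g = 0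
    · rw [map_mul, map_mul, hgw, zero_mul, zero_mul, zero_mul]
    · have h1 := hgN (modelPoint hn hw hwm) (mt (vanishesAt_mk hg w hw).1 hgw)
      obtain ⟨h2, h3⟩ := hab _ h1
      obtain ⟨s, hs, hsw⟩ := exists_rep_mk w hw
      have hsw' : (modelPoint hn hw hwm).1.rep = s • w := funext hsw
      rw [Function.comp_apply, powerMap_modelPoint hn hk hw hwm hy hwy, hsw',
        eval_smul_of_isHomogeneous ha, eval_smul_of_isHomogeneous hbh,
        mul_div_mul_left _ _ (pow_ne_zero _ hs)] at h3
      have h4 : eval w b ≠ 0 := mt (vanishesAt_mk hbh w hw).2 h2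
      rw [h3, map_mul, map_mul, mul_assoc, mul_div_cancel₀ _ h4]
  have hgb : eval v (g * b) ≠ 0 := by
    rw [map_mul]
    refine mul_ne_zero (mt (vanishesAt_mk hg v hv).2 hgv) (mt (vanishesAt_mk hbh v hv).2 ?_)
    exact (hab _ (hgN _ hgv)).1
  obtain ⟨c, hc⟩ := exists_sum_twist_mul_ne_zero hω hgb
  obtain ⟨A, hA⟩ := exists_average hn Λ hω (g * a * c)
  obtain ⟨B, hB⟩ := exists_average hn Λ hω (g * b * c)
  have hAB : ∀ (y : Fin (d + 1) → K) (hy : y ≠ 0),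
      eval y B * f ⟨Projectivization.mk K y hy, trivial⟩ = eval y A := by
    intro y hy
    obtain ⟨w, hw, hwm, hwy⟩ := exists_modelEquations hn hk0 Λ hy
    have hAy : eval y A = ∑ t : Fin (n + 1) → Fin k, eval (twist ω t w) (g * a * c) := by
      rw [hA w hwm, hwy]
    have hBy : eval y B = ∑ t : Fin (n + 1) → Fin k, eval (twist ω t w) (g * b * c) := by
      rw [hB w hwm, hwy]
    rw [hAy, hBy, Finset.sum_mul]
    refine Finset.sum_congr rfl fun t _ => ?_
    have := hrep (twist ω t w) (twist_ne_zero hω t hw) (modelEquations_twist hn hω t hwm) y hy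
      (by rw [basePow_twist hn hω, hwy])
    rw [map_mul _ (g * b) c, map_mul _ (g * a) c, ← this]
    ring
  have hBQ : eval Q.1.rep B ≠ 0 := by rwa [← hb, ← hB v hvm]
  obtain ⟨i, hi⟩ := exists_homogeneousComponent_eval_ne_zero hBQ
  refine ⟨{y | ¬ VanishesAt (homogeneousComponent i B) y.1}, isOpen_nonvanishing_subtype _
    (homogeneousComponent_isHomogeneous i B), hi, i, _, _, homogeneousComponent_isHomogeneous i A,
    homogeneousComponent_isHomogeneous i B, fun y hy => ⟨hy.1, ?_⟩⟩
  rw [eq_div_iff hy.1]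
  -- The value `f y` is constant along the line through `y`, so the identity can be compared degree
  -- by degree.
  have h1 := eval_homogeneousComponent_eq_zero (C (f y) * B - A) y.1.rep (fun t ht => by
    have h2 := hAB (t • y.1.rep) (smul_ne_zero ht y.1.rep_nonzero)
    have h3 : (⟨Projectivization.mk K (t • y.1.rep) (smul_ne_zero ht y.1.rep_nonzero), trivial⟩ :
        fullSpace K d) = y := by
      refine Subtype.ext ?_
      conv_rhs => rw [← y.1.mk_rep]
      exact (Projectivization.mk_eq_mk_iff' K _ _ _ _).2 ⟨t, rfl⟩
    rw [h3] at h2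
    rw [map_sub, map_mul, eval_C, mul_comm, h2, sub_self]) i
  rw [map_sub, homogeneousComponent_C_mul, map_sub, map_mul, eval_C, sub_eq_zero] at h1
  exact h1

theorem isGaloisCover_powerMap [IsAlgClosed K] (hn : d + 1 ≤ n) {k : ℕ} (hk : 2 ≤ k)
    [NeZero (k : K)] {Λ : Fin (n - d - 1) → Fin d → K} {ω : Kˣ} (hω : IsPrimitiveRoot ω k)
    (hirr : IsIrreducible (model hn k Λ)) :
    IsGaloisCover (groupH0 hn Λ hω.pow_eq_one) (powerMap hn hk Λ) := by
  have hk0 : k ≠ 0 := by omega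
  have : NeZero k := ⟨hk0⟩
  have hωK : IsPrimitiveRoot (ω : K) k := IsPrimitiveRoot.coe_units_iff.2 hω
  have hrange := groupH0_eq_range hn Λ hω
  refine ⟨isMorphism_powerMap hn hk Λ, ?_, fun g => ⟨?_, ?_⟩, surjective_powerMap hn hk Λ,
    fun x y hxy => ?_, fun V hV => isOpen_of_isOpen_preimage_powerMap hn hk hωK hV,
    fun V f hV hf => regularOn_of_regularOn_comp_powerMap hn hk hωK hV hf⟩
  · rw [hrange]
    exact Set.finite_range (diagHom hn k Λ)
  · rw [hrange]
    rintro ⟨u, rfl⟩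
    exact ⟨diagHom_mem_autGroup hn Λ u, powerMap_diagHom hn hk Λ u⟩
  · rintro ⟨hg, hgπ⟩
    have := Subtype.irreducibleSpace hirr
    -- The irreducible model is the finite union of the closed sets where `g` agrees with a diagonal
    -- map, so one of them is everything. The images have the same zero coordinates because these
    -- are read off from `π_0`.
    obtain ⟨u, hu⟩ := exists_subset_of_isIrreducible
      (IrreducibleSpace.isIrreducible_univ (model hn k Λ))
      (C := fun u => {x | g x = diagHom hn k Λ u x}) (fun u =>
        isClosed_setOf_eq_of_isMorphism hg.1 (diagHom_mem_autGroup hn Λ u).1 fun x i => by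
          rw [← powerMap_mem_hyperplane_iff hn hk, ← powerMap_mem_hyperplane_iff hn hk, hgπ,
            powerMap_diagHom]) (fun x _ => by
        obtain ⟨u, hu⟩ := exists_diagHom_eq hn hk (hgπ x).symm
        exact Set.mem_iUnion.2 ⟨u, hu.symm⟩)
    rw [hrange]
    exact ⟨u, Equiv.ext fun x => (hu (Set.mem_univ x)).symm⟩
  · obtain ⟨u, hu⟩ := exists_diagHom_eq hn hk hxy
    exact ⟨_, hrange ▸ ⟨u, rfl⟩, hu⟩

end Cover

/-! ## Ramification -/

section Branch

open MvPolynomial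

variable {K : Type*} [Field K] {d n : ℕ}

theorem exists_linear_path {σ : Type*} (v w : σ → K) (f : MvPolynomial σ K) :
    ∃ q : Polynomial K, ∀ t, q.eval t = eval (v + t • (w - v)) f := by
  refine ⟨aeval (fun i => Polynomial.C (v i) + Polynomial.X * Polynomial.C (w i - v i)) f,
    fun t => ?_⟩
  have : (Polynomial.evalRingHom t).comp (aeval (R := K) (fun i =>
      Polynomial.C (v i) + Polynomial.X * Polynomial.C (w i - v i)) :
      MvPolynomial σ K →ₐ[K] Polynomial K).toRingHom = eval (v + t • (w - v)) := by
    ext <;> simp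
  exact RingHom.congr_fun this f

/-- Two points are joined by a line inside `W`, on which `f` and `g` restrict to non-zero
polynomials in one variable. A third factor, a coordinate not vanishing at `P`, keeps the chosen
point away from the origin. -/
theorem isIrreducible_setOf_rep_mem [Infinite K] {W : Submodule K (Fin (d + 1) → K)}
    (hW : ∃ v ∈ W, v ≠ 0) : IsIrreducible {P : PSpace K d | P.rep ∈ W} := by
  have hmk : ∀ (v : Fin (d + 1) → K) (hv : v ≠ 0), v ∈ W →
      (Projectivization.mk K v hv).rep ∈ W := fun v hv hvW => by
    obtain ⟨c, -, hc⟩ := exists_rep_mk v hv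
    rw [show (Projectivization.mk K v hv).rep = c • v from funext hc]
    exact W.smul_mem c hvW
  obtain ⟨v, hvW, hv⟩ := hW
  refine isIrreducible_of_mul ⟨Projectivization.mk K v hv, hmk v hv hvW⟩ ?_
  rintro e e' f g hf hg ⟨P, hP, hPf⟩ ⟨Q, hQ, hQg⟩
  obtain ⟨i, hi⟩ := Function.ne_iff.1 P.rep_nonzero
  obtain ⟨q, hq⟩ := exists_linear_path P.rep Q.rep f
  obtain ⟨q', hq'⟩ := exists_linear_path P.rep Q.rep g
  obtain ⟨r, hr⟩ := exists_linear_path P.rep Q.rep (X i)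
  have h1 : q ≠ 0 := fun h0 => hPf (by simpa [h0, VanishesAt] using (hq 0).symm)
  have h2 : q' ≠ 0 := fun h0 => hQg (by simpa [h0, VanishesAt] using (hq' 1).symm)
  have h3 : r ≠ 0 := fun h0 => hi (by simpa [h0] using (hr 0).symm)
  obtain ⟨t, ht⟩ : ∃ t, (q * q' * r).eval t ≠ 0 := by
    by_contra! hc
    exact mul_ne_zero (mul_ne_zero h1 h2) h3 (Polynomial.funext fun t => by simp [hc t])
  rw [Polynomial.eval_mul, Polynomial.eval_mul, hq, hq', hr, ← map_mul] at ht
  have hw : P.rep + t • (Q.rep - P.rep) ≠ 0 := fun h0 => by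
    rw [h0] at ht
    simp at ht
  refine ⟨Projectivization.mk K _ hw, hmk _ hw
    (W.add_mem hP (W.smul_mem t (W.sub_mem hQ hP))), ?_⟩
  rw [vanishesAt_mk (hf.mul hg)]
  exact left_ne_zero_of_mul ht

theorem mem_hyperplane_iff {ρ : Fin (d + 1) → K} (Q : fullSpace K d) :
    Q ∈ hyperplane ρ ↔ linForm ρ Q.1.rep = 0 := by
  rw [linForm_apply]; rfl

theorem isClosed_hyperplane (ρ : Fin (d + 1) → K) : IsClosed (hyperplane ρ) := by
  have := (isOpen_nonvanishing_subtype (fullSpace K d) (isHomogeneous_linPoly ρ)).isClosed_compl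
  convert this using 1
  ext Q
  rw [mem_hyperplane_iff, Set.mem_compl_iff, Set.mem_ofPred_eq, not_not, VanishesAt, eval_linPoly]

theorem isIrreducible_hyperplane [Infinite K] {ρ : Fin (d + 1) → K}
    (h : ∃ y, y ≠ 0 ∧ linForm ρ y = 0) : IsIrreducible (hyperplane ρ) := by
  obtain ⟨y, hy, hy0⟩ := h
  have h1 := isIrreducible_setOf_rep_mem (W := LinearMap.ker (linForm ρ)) ⟨y, hy0, hy⟩
  have h2 : hyperplane ρ = (fun P : PSpace K d => (⟨P, trivial⟩ : fullSpace K d)) ''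
      {P : PSpace K d | P.rep ∈ LinearMap.ker (linForm ρ)} := by
    ext Q
    rw [mem_hyperplane_iff]
    constructor
    · exact fun hQ => ⟨Q.1, hQ, rfl⟩
    · rintro ⟨P, hP, rfl⟩
      exact hP
  rw [h2]
  exact h1.image _ (Continuous.continuousOn (by fun_prop))

/-- Under a finite quotient map, the irreducible components of the preimage of an irreducible
closed set are mapped onto it. -/
theorem subset_image_of_maximal {X Y : Type*} [TopologicalSpace X] [TopologicalSpace Y]
    [TopologicalSpace.NoetherianSpace X] {H : Subgroup (Equiv.Perm X)} [Finite H]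
    (hH : ∀ h ∈ H, Continuous h) {π : X → Y} (hπ : Continuous π) (hsurj : Function.Surjective π)
    (hinv : ∀ h ∈ H, ∀ x, π (h x) = π x) (hfib : ∀ x y, π x = π y → ∃ h ∈ H, h x = y)
    (hopen : ∀ V : Set Y, IsOpen (π ⁻¹' V) → IsOpen V) {S : Set Y} (hSc : IsClosed S)
    (hS : IsIrreducible S) {T : Set X}
    (hT : Maximal (fun T' => IsIrreducible T' ∧ T' ⊆ π ⁻¹' S) T) : S ⊆ π '' T := by
  have himage : ∀ (h : Equiv.Perm X) (A : Set X), h '' A = ⇑h⁻¹ ⁻¹' A := fun h A =>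
    Equiv.image_eq_preimage_symm h A
  have hpre : ∀ A : Set X, π ⁻¹' (π '' A) = ⋃ h : H, (h : Equiv.Perm X) '' A := by
    intro A
    ext x
    simp only [Set.mem_preimage, Set.mem_image, Set.mem_iUnion]
    constructor
    · rintro ⟨y, hy, hyx⟩
      obtain ⟨h, hh, rfl⟩ := hfib y x hyx
      exact ⟨⟨h, hh⟩, y, hy, rfl⟩
    · rintro ⟨h, y, hy, rfl⟩
      exact ⟨y, hy, (hinv h h.2 y).symm⟩
  have htrans : ∀ (h : H) {A : Set X}, IsClosed A → IsClosed ((h : Equiv.Perm X) '' A) :=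
    fun h A hA => by
      rw [himage]
      exact hA.preimage (hH _ (H.inv_mem h.2))
  have hclosed : ∀ {A : Set X}, IsClosed A → IsClosed (π '' A) := fun {A} hA => by
    rw [← isOpen_compl_iff]
    refine hopen _ ?_
    rw [Set.preimage_compl, hpre]
    exact (isClosed_iUnion_of_finite fun h => htrans h hA).isOpen_compl
  obtain ⟨C, hCf, hCc, hCi, hCS⟩ :=
    TopologicalSpace.NoetherianSpace.exists_finite_set_isClosed_irreducible (hSc.preimage hπ)
  have : Finite C := hCf
  -- The images of the finitely many irreducible closed pieces of the preimage are closed and cover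
  -- `S`, so one piece `A` already maps onto `S`.
  obtain ⟨⟨A, hA⟩, hSA⟩ := exists_subset_of_isIrreducible hS (C := fun A : C => π '' A)
    (fun A => hclosed (hCc A A.2)) (fun s hs => by
      obtain ⟨x, rfl⟩ := hsurj s
      obtain ⟨A, hA, hxA⟩ := hCS.subset hs
      exact Set.mem_iUnion.2 ⟨⟨A, hA⟩, x, hxA, rfl⟩)
  -- Since `T` is irreducible and covered by the translates of `A`, it lies in one of them, and
  -- maximality gives equality.
  obtain ⟨h, hTh⟩ := exists_subset_of_isIrreducible hT.prop.1
    (C := fun h : H => (h : Equiv.Perm X) '' A) (fun h => htrans h (hCc A hA))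
    ((hT.prop.2.trans (Set.preimage_mono hSA)).trans (hpre A).subset)
  have hle : (h : Equiv.Perm X) '' A ⊆ T := by
    refine hT.le_of_ge ⟨(hCi A hA).image _ (hH h h.2).continuousOn, ?_⟩ hTh
    rintro _ ⟨x, hx, rfl⟩
    rw [Set.mem_preimage, hinv h h.2]
    exact hCS.symm.subset ⟨A, hA, hx⟩
  intro s hs
  obtain ⟨x, hx, rfl⟩ := hSA hs
  exact ⟨h.1 x, hle ⟨x, hx, rfl⟩, hinv h h.2 x⟩

theorem diagHom_mulSingle_apply (hn : d + 1 ≤ n) {k : ℕ} {Λ : Fin (n - d - 1) → Fin d → K}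
    {j : Fin (n + 1)} (c : rootsOfUnity k K) {x : model hn k Λ} (hx : x.1.rep j = 0) :
    diagHom hn k Λ (Pi.mulSingle j c) x = x := by
  refine (diagHom_apply_eq_iff hn _ x x).2 ⟨1, one_ne_zero, fun i => ?_⟩
  by_cases hij : i = j
  · subst hij; simp [hx]
  · simp [hij]

theorem injective_diagHom_mulSingle [IsAlgClosed K] (hd : 1 ≤ d) (hn : d + 1 ≤ n) {k : ℕ}
    (hk : 2 ≤ k) {Λ : Fin (n - d - 1) → Fin d → K}
    (hΛ : GeneralPosition (sigmaCoeff (n := n) Λ)) (j : Fin (n + 1)) :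
    Function.Injective ((diagHom hn k Λ).comp
      (MonoidHom.mulSingle (fun _ : Fin (n + 1) => rootsOfUnity k K) j)) := by
  rw [injective_iff_map_eq_one]
  intro c hc
  obtain ⟨x, hx⟩ := exists_rep_ne_zero hn hk hΛ
  have : Nontrivial (Fin (n + 1)) := Fin.nontrivial_iff_two_le.2 (by omega)
  obtain ⟨i, hi⟩ := exists_ne j
  have h1 : diagHom hn k Λ (Pi.mulSingle j c) = 1 := hc
  have := eq_of_diagHom_apply_eq hn (x := x) (by rw [h1]; rfl) (hx j) (hx i)
  simpa [hi] using this

/-- If no coordinate vanishes, only scalar matrices fix the point, and they act trivially. If `x_j =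
0`, then `φ_j` is a non-trivial element of the stabilizer. -/
theorem image_ramificationLocus [IsAlgClosed K] (hd : 1 ≤ d) (hn : d + 1 ≤ n) {k : ℕ}
    (hk : 2 ≤ k) {Λ : Fin (n - d - 1) → Fin d → K}
    (hΛ : GeneralPosition (sigmaCoeff (n := n) Λ)) {ω : Kˣ} (hω : IsPrimitiveRoot ω k) :
    powerMap hn hk Λ '' ramificationLocus (groupH0 hn Λ hω.pow_eq_one) =
      ⋃ j : Fin (n + 1), hyperplane (sigmaCoeff Λ j) := by
  have : NeZero k := ⟨by omega⟩
  have hrange := groupH0_eq_range hn Λ hω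
  ext Q
  rw [Set.mem_iUnion]
  constructor
  · rintro ⟨x, ⟨h, hh, h1, hx⟩, rfl⟩
    by_contra! hc
    simp only [powerMap_mem_hyperplane_iff] at hc
    rw [hrange] at hh
    obtain ⟨u, rfl⟩ := hh
    exact h1 (diagHom_eq_one_of_apply_eq hn hc hx)
  · rintro ⟨j, hj⟩
    obtain ⟨x, rfl⟩ := surjective_powerMap hn hk Λ Q
    rw [powerMap_mem_hyperplane_iff] at hj
    refine ⟨x, ⟨phi hn Λ hω.pow_eq_one j, Subgroup.subset_closure ⟨j, rfl⟩, fun h1 => ?_, ?_⟩, rfl⟩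
    · rw [phi_eq_diagHom] at h1
      have h2 := injective_diagHom_mulSingle hd hn hk hΛ j (h1.trans (map_one _).symm)
      exact hω.ne_one (by omega) (congrArg Subtype.val h2)
    · rw [phi_eq_diagHom]
      exact diagHom_mulSingle_apply hn _ hj

/-- The component `T` maps onto `Σ_j`, so it contains a point `x` over a point of `Σ_j` on no other
hyperplane. An element fixing `x` has equal entries away from `j`, hence is a scaling of `x_j` up to
scalars. Conversely, these `k` scalings fix all of `{x_j = 0}`. -/
theorem hasBranchOrder_powerMap [IsAlgClosed K] (hd : 1 ≤ d) (hn : d + 1 ≤ n) {k : ℕ}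
    (hk : 2 ≤ k) {Λ : Fin (n - d - 1) → Fin d → K}
    (hΛ : GeneralPosition (sigmaCoeff (n := n) Λ)) {ω : Kˣ} (hω : IsPrimitiveRoot ω k)
    (hcov : IsGaloisCover (groupH0 hn Λ hω.pow_eq_one) (powerMap hn hk Λ)) (j : Fin (n + 1)) :
    HasBranchOrder (groupH0 hn Λ hω.pow_eq_one) (powerMap hn hk Λ)
      (hyperplane (sigmaCoeff Λ j)) k := by
  have : NeZero k := ⟨by omega⟩
  have := IsAlgClosed.instInfinite (K := K)
  have hrange := groupH0_eq_range hn Λ hω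
  intro T hT
  obtain ⟨y, hy, hyj, hyi⟩ := exists_generic_vector_of_hyperplane hd hn hΛ j
  have := hcov.finite
  obtain ⟨x, hxT, hx⟩ := subset_image_of_maximal
    (fun h hh => ((hcov.mem_iff h).1 hh).1.1.continuous)
    hcov.isMorphism.continuous hcov.surjective (fun h hh => ((hcov.mem_iff h).1 hh).2) hcov.fibre
    hcov.isOpen (isClosed_hyperplane _) (isIrreducible_hyperplane ⟨y, hy, hyj⟩) hT
    (show (⟨Projectivization.mk K y hy, trivial⟩ : fullSpace K d) ∈ _ from by
      obtain ⟨c, -, h⟩ := exists_rep_mk y hy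
      rw [mem_hyperplane_iff, show (Projectivization.mk K y hy).rep = c • y from funext h,
        map_smul, hyj, smul_zero])
  have hxi : ∀ i ≠ j, x.1.rep i ≠ 0 := by
    intro i hi h0
    rw [← powerMap_mem_hyperplane_iff hn hk, hx, mem_hyperplane_iff] at h0
    obtain ⟨c, hc, h⟩ := exists_rep_mk y hy
    rw [show (Projectivization.mk K y hy).rep = c • y from funext h, map_smul,
      smul_eq_zero_iff_right hc] at h0
    exact hyi i hi h0
  have hin : inertia (groupH0 hn Λ hω.pow_eq_one) T = ((diagHom hn k Λ).comp
      (MonoidHom.mulSingle (fun _ : Fin (n + 1) => rootsOfUnity k K) j)).range := by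
    apply le_antisymm
    · rintro h ⟨hh, hhT⟩
      rw [hrange] at hh
      obtain ⟨u, rfl⟩ := hh
      have : Nontrivial (Fin (n + 1)) := Fin.nontrivial_iff_two_le.2 (by omega)
      obtain ⟨i₀, hi₀⟩ := exists_ne j
      refine ⟨(u i₀)⁻¹ * u j, ?_⟩
      have hu : u = (fun _ => u i₀) * Pi.mulSingle j ((u i₀)⁻¹ * u j) := by
        funext i
        by_cases hi : i = j
        · subst hi; simp
        · simpa [hi] using eq_of_diagHom_apply_eq hn (hhT x hxT) (hxi i hi) (hxi i₀ hi₀)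
      conv_rhs => rw [hu, map_mul, diagHom_const, one_mul]
      rfl
    · rintro _ ⟨c, rfl⟩
      refine ⟨?_, fun z hz => diagHom_mulSingle_apply hn c
        ((powerMap_mem_hyperplane_iff hn hk z j).1 (hT.prop.2 hz))⟩
      rw [hrange]
      exact ⟨_, rfl⟩
  rw [hin, ← Nat.card_congr
    (MonoidHom.ofInjective (injective_diagHom_mulSingle hd hn hk hΛ j)).toEquiv,
    hω.card_rootsOfUnity']

end Branch

end FermatPair

end

/-! ### The generalized Fermat pair -/

theorem mainTheorem7 {K : Type*} [Field K] [IsAlgClosed K] (p : ℕ) [Fact p.Prime] [CharP K p]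
    (d k n : ℕ) (hd : 1 ≤ d) (hn : d + 1 ≤ n) (hk : 2 ≤ k) (hkp : k.Coprime p)
    (Λ : Fin (n - d - 1) → Fin d → K) (hΛ : Λ ∈ FermatPair.paramSpace K n d)
    (ω : Kˣ) (hω : IsPrimitiveRoot ω k) :
    FermatPair.IsGeneralizedFermatPair d k n (FermatPair.model hn k Λ)
        (FermatPair.groupH0 hn Λ hω.pow_eq_one) ∧
      FermatPair.IsGeneralizedFermatCover d k n (FermatPair.model hn k Λ)
        (FermatPair.groupH0 hn Λ hω.pow_eq_one) (FermatPair.powerMap hn hk Λ)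
        (FermatPair.sigmaCoeff Λ) := by
  have hk0 : (k : K) ≠ 0 := by
    rw [Ne, CharP.cast_eq_zero_iff K p]
    intro h
    have := Nat.dvd_gcd h dvd_rfl
    rw [hkp] at this
    exact (Fact.out : p.Prime).one_lt.ne' (Nat.dvd_one.1 this)
  have : NeZero (k : K) := ⟨hk0⟩
  have hX := FermatPair.isSmoothProjectiveVariety_model hd hn hk hΛ
    (IsPrimitiveRoot.coe_units_iff.2 hω)
  have hcov := FermatPair.isGaloisCover_powerMap hn hk hω hX.isIrreducible
  have hmain : FermatPair.IsGeneralizedFermatCover d k n (FermatPair.model hn k Λ)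
      (FermatPair.groupH0 hn Λ hω.pow_eq_one) (FermatPair.powerMap hn hk Λ)
      (FermatPair.sigmaCoeff Λ) :=
    { variety := hX
      group_le := fun g hg => ((hcov.mem_iff g).1 hg).1
      group_iso := FermatPair.nonempty_groupH0_equiv hn hk hΛ hω
      cover := hcov
      generalPosition := hΛ
      branchLocus := FermatPair.image_ramificationLocus hd hn hk hΛ hω
      branchOrder := FermatPair.hasBranchOrder_powerMap hd hn hk hΛ hω hcov }
  exact ⟨⟨hd, hn, hk, hk0, _, _, hmain⟩, hmain⟩
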